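/- Let $X,Y$ be finite sets and let $f:X\times Y\to\{0,1\}$. A non-local box is a device shared by Alice and Bob: Alice enters a bit $p$ and immediately receives a bit $a$, Bob enters a bit $q$ and immediately receives a bit $b$, where $(a,b)$ has probability $\tfrac12$ if $a\oplus b=p\wedge q$ and $0$ otherwise. In a protocol with $t$ non-local boxes Alice gets $x\in X$ and Bob gets $y\in Y$; they have shared randomness but no communication, each player may use each of the $t$ boxes at most once, in an order and with inputs that may depend adaptively on his own input, the shared randomness and the bits he has received so far, and at the end Alice outputs a bit $A$ and Bob a bit $B$. Let $NL_\varepsilon(f)$ be the smallest $t$ for which there is such a protocol with $\Pr[A\oplus B=f(x,y)]\ge 1-\varepsilon$ for all $(x,y)\in X\times Y$. For a real matrix $M$ let $\gamma_2(M)=\min_{U^{T}V=M}\mathrm{col}(U)\,\mathrm{col}(V)$, where $\mathrm{col}(N)$ is the largest Euclidean norm of a column of $N$. Let $M_f=\big((-1)^{f(x,y)}\big)_{x,y}$ be the sign matrix of $f$. For $\alpha\ge 1$ let $\gamma_2^\alpha(f)$ be the minimum of $\gamma_2(N)$ over the real matrices $N$ with $1\le M_f(x,y)N(x,y)\le\alpha$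 for all $x,y$, and let $\gamma_2^\infty(f)$ be the minimum of $\gamma_2(N)$ over those with $1\le M_f(x,y)N(x,y)$ for all $x,y$. Then: 1. For every $0\le\varepsilon<\tfrac12$ and all $X,Y,f$ as above, with $\alpha=\frac{1}{1-2\varepsilon}$, $$2\log_2\!\big(\gamma_2^\alpha(f)/\alpha\big)\le NL_\varepsilon(f).$$ 2. For every $0<\varepsilon<\tfrac12$ there is a constant $C>0$, depending only on $\varepsilon$, such that for all $X,Y,f$ as above, $$NL_\varepsilon(f)\le C\,\big(\gamma_2^\infty(f)\big)^2.$$ -/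

import Mathlib

open scoped ENNReal Matrix

universe u v

/-! ### Non-local boxes -/

/-- The non-local box: the probability of the output pair `(a, b)` on the input pair `(x, y)`. It is
`1/2` if `a ⊕ b = x ∧ y`, and `0` otherwise. -/
noncomputable def nonLocalBox (x y a b : Bool) : ℝ≥0∞ :=
  if xor a b = (x && y) then 2⁻¹ else 0

/-- A deterministic adaptive strategy of one player, as a decision tree; `S` is the set of labels of
the boxes which the player has not used yet. The player either halts and outputs a bit, or puts a bit
`p` into an unused box `i` of his choice and continues depending on the bit that this box returns. In
particular the player chooses the order in which he uses the boxes, and this order may be adaptive. -/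
inductive LocalStrategy {t : ℕ} : Finset (Fin t) → Type
  | halt {S : Finset (Fin t)} (out : Bool) : LocalStrategy S
  | use {S : Finset (Fin t)} (i : Fin t) (hi : i ∈ S) (p : Bool)
      (next : Bool → LocalStrategy (S.erase i)) : LocalStrategy S

namespace LocalStrategy

variable {t : ℕ}

/-- The bit that the player puts into box `j`, in the run in which box `i` returns the bit `a i` to
him, for each `i`. (A box that the player does not use in this run gets the default input `0`: by
non-signaling, this does not influence anything that the players see.) -/
def input : {S : Finset (Fin t)} → LocalStrategy S → (Fin t → Bool) → Fin t → Bool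
  | _, halt _, _, _ => false
  | _, use i _ p next, a, j => if j = i then p else (next (a i)).input a j

/-- The final output of the player, in the run in which box `i` returns the bit `a i` to him. -/
def output : {S : Finset (Fin t)} → LocalStrategy S → (Fin t → Bool) → Bool
  | _, halt out, _ => out
  | _, use i _ _ next, a => (next (a i)).output a

end LocalStrategy

/-- A protocol with `t` non-local boxes, without communication and without shared randomness: each
player has a strategy that depends only on his own input. -/
structure DetProtocol (X : Type u) (Y : Type v) (t : ℕ) where
  alice : X → LocalStrategy (Finset.univ : Finset (Fin t))
  bob : Y → LocalStrategy (Finset.univ : Finset (Fin t))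

namespace DetProtocol

variable {X : Type u} {Y : Type v} {t : ℕ}

/-- The probability, on inputs `x` and `y`, that the boxes return the bits `a` to Alice and the bits
`b` to Bob. -/
noncomputable def boxProb (P : DetProtocol X Y t) (x : X) (y : Y) (a b : Fin t → Bool) : ℝ≥0∞ :=
  ∏ i, nonLocalBox ((P.alice x).input a i) ((P.bob y).input b i) (a i) (b i)

/-- The probability, over the randomness of the boxes, that the exclusive or of the outputs of Alice
and Bob is `f x y`, on inputs `x` and `y`. -/
noncomputable def successProb (P : DetProtocol X Y t) (f : X → Y → Bool) (x : X) (y : Y) : ℝ≥0∞ :=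
  ∑ a : Fin t → Bool, ∑ b : Fin t → Bool,
    if xor ((P.alice x).output a) ((P.bob y).output b) = f x y then P.boxProb x y a b else 0

end DetProtocol

/-- There is a protocol with shared randomness and `t` non-local boxes which, on every input pair,
computes `f` in parity with probability at least `1 - ε`. Shared randomness is a probability
distribution on the deterministic protocols (for finite `X` and `Y`, there are only finitely many of
these, so a discrete distribution is no restriction). -/
def NLComputable {X : Type u} {Y : Type v} (ε : ℝ) (f : X → Y → Bool) (t : ℕ) : Prop :=
  ∃ μ : PMF (DetProtocol X Y t), ∀ x y,
    ENNReal.ofReal (1 - ε) ≤ ∑' P, μ P * P.successProb f x y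

/-- The `ε`-error non-local box complexity of `f`: the smallest number of non-local boxes. -/
noncomputable def NL {X : Type u} {Y : Type v} (ε : ℝ) (f : X → Y → Bool) : ℕ :=
  sInf {t | NLComputable ε f t}

/-! The minimum in the definition of `NL` is over a non-empty set: for finite `X`, every function is
computed without error with `|X|` boxes. -/

theorem LocalStrategy.exists_parallel {t : ℕ} (p : Fin t → Bool) (S : Finset (Fin t)) :
    ∀ out : (Fin t → Bool) → Bool, (∀ a a', (∀ i ∈ S, a i = a' i) → out a = out a') →
      ∃ s : LocalStrategy S, (∀ a, ∀ j ∈ S, s.input a j = p j) ∧ ∀ a, s.output a = out a := by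
  induction S using Finset.strongInduction with
  | H S ih =>
    intro out hout
    rcases S.eq_empty_or_nonempty with rfl | ⟨i, hi⟩
    · exact ⟨.halt (out fun _ => false), by simp, fun a => hout _ _ (by simp)⟩
    · have key : ∀ c : Bool, ∃ s : LocalStrategy (S.erase i),
          (∀ a, ∀ j ∈ S.erase i, s.input a j = p j) ∧
            ∀ a, s.output a = out (Function.update a i c) := by
        intro c
        refine ih _ (Finset.erase_ssubset hi) _ fun a a' h => hout _ _ fun j hj => ?_
        by_cases hji : j = i
        · subst hji; simp
        · simp [Function.update_of_ne hji, h j (Finset.mem_erase.2 ⟨hji, hj⟩)]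
      choose next h1 h2 using key
      refine ⟨.use i hi (p i) next, fun a j hj => ?_, fun a => ?_⟩
      · by_cases hji : j = i
        · subst hji; simp [LocalStrategy.input]
        · simp [LocalStrategy.input, hji, h1 (a i) a j (Finset.mem_erase.2 ⟨hji, hj⟩)]
      · simp [LocalStrategy.output, h2]

theorem exists_NLComputable {X : Type u} {Y : Type v} [Fintype X] {ε : ℝ} (hε : 0 ≤ ε)
    (f : X → Y → Bool) : NLComputable ε f (Fintype.card X) := by
  classical
  let e := Fintype.equivFin X
  let g : Bool → ZMod 2 := fun b => if b then 1 else 0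
  have hg : ∀ b c : Bool, g (xor b c) = g b + g c := by decide
  have hgi : ∀ b c : Bool, g b = g c → b = c := by decide
  let par : (Fin (Fintype.card X) → Bool) → Bool := fun a => decide (∑ i, g (a i) = 1)
  have hpar : ∀ a, g (par a) = ∑ i, g (a i) := by
    have : ∀ z : ZMod 2, g (decide (z = 1)) = z := by decide
    exact fun a => this _
  have hA := fun x => LocalStrategy.exists_parallel (fun i => decide (i = e x)) Finset.univ par
    (fun a a' h => by rw [show a = a' from funext fun i => h i (Finset.mem_univ i)])
  have hB := fun y => LocalStrategy.exists_parallel (fun i => f (e.symm i) y) Finset.univ par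
    (fun a a' h => by rw [show a = a' from funext fun i => h i (Finset.mem_univ i)])
  choose A hA1 hA2 using hA
  choose B hB1 hB2 using hB
  refine ⟨PMF.pure ⟨A, B⟩, fun x y => ?_⟩
  have hsucc : DetProtocol.successProb ⟨A, B⟩ f x y = 1 := by
    unfold DetProtocol.successProb DetProtocol.boxProb
    have h : ∀ a b : Fin (Fintype.card X) → Bool,
        (if xor ((A x).output a) ((B y).output b) = f x y then
          ∏ i, nonLocalBox ((A x).input a i) ((B y).input b i) (a i) (b i) else 0)
        = ∏ i, nonLocalBox (decide (i = e x)) (f (e.symm i) y) (a i) (b i) := by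
      intro a b
      simp only [hA2, hB2, hA1 x a _ (Finset.mem_univ _), hB1 y b _ (Finset.mem_univ _)]
      split_ifs with hc
      · rfl
      · by_contra hne
        have hall : ∀ i, xor (a i) (b i) = (decide (i = e x) && f (e.symm i) y) := by
          intro i
          by_contra hi
          exact hne (Finset.prod_eq_zero (Finset.mem_univ i) (by simp only [nonLocalBox, if_neg hi])).symm
        apply hc
        apply hgi
        rw [hg, hpar, hpar, ← Finset.sum_add_distrib]
        simp only [← hg, hall]
        rw [Finset.sum_eq_single (e x)]
        · simp
        · intro i _ hi; simp [hi, g]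
        · simp
    simp only [h]
    have h1 : ∀ a : Fin (Fintype.card X) → Bool,
        ∑ b : Fin (Fintype.card X) → Bool,
          ∏ i, nonLocalBox (decide (i = e x)) (f (e.symm i) y) (a i) (b i) =
        ∏ i, ∑ c : Bool, nonLocalBox (decide (i = e x)) (f (e.symm i) y) (a i) c := by
      intro a
      rw [Finset.prod_univ_sum, Fintype.piFinset_univ]
    have h2 : ∀ p q a : Bool, ∑ c : Bool, nonLocalBox p q a c = 2⁻¹ := by
      intro p q a
      cases p <;> cases q <;> cases a <;> simp [nonLocalBox]
    simp only [h1, h2, Finset.prod_const, Finset.sum_const, Finset.card_univ, Fintype.card_fun,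
      Fintype.card_fin, Fintype.card_bool, nsmul_eq_mul, Nat.cast_pow, Nat.cast_ofNat]
    rw [← mul_pow, ENNReal.mul_inv_cancel (by simp) (by simp), one_pow]
  rw [tsum_eq_single (⟨A, B⟩ : DetProtocol X Y (Fintype.card X))]
  · rw [hsucc, PMF.pure_apply, if_pos rfl, one_mul]
    exact ENNReal.ofReal_le_one.2 (by linarith)
  · intro P hP
    rw [PMF.pure_apply, if_neg hP, zero_mul]

/-! ### Factorization norms -/

/-- The largest Euclidean norm of a column of `N`. -/
noncomputable def maxColNorm {k n : Type*} [Fintype k] (N : Matrix k n ℝ) : ℝ :=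
  ⨆ j, √(∑ i, N i j ^ 2)

/-- The norm `γ₂` of a real matrix: the minimum of `col U * col V` over all `U`, `V` with
`Uᵀ V = M`, where `col` is the largest Euclidean norm of a column. -/
noncomputable def gamma2 {m n : Type*} (M : Matrix m n ℝ) : ℝ :=
  sInf {c | ∃ (k : ℕ) (U : Matrix (Fin k) m ℝ) (V : Matrix (Fin k) n ℝ),
    Uᵀ * V = M ∧ c = maxColNorm U * maxColNorm V}

/-- The norm `γ₂^α` of a sign matrix `M`, for real `α ≥ 1`. -/
noncomputable def gamma2Approx {m n : Type*} (α : ℝ) (M : Matrix m n ℝ) : ℝ :=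
  sInf {c | ∃ N : Matrix m n ℝ, (∀ i j, 1 ≤ M i j * N i j ∧ M i j * N i j ≤ α) ∧ c = gamma2 N}

/-- The norm `γ₂^∞` of a sign matrix `M`. -/
noncomputable def gamma2Infty {m n : Type*} (M : Matrix m n ℝ) : ℝ :=
  sInf {c | ∃ N : Matrix m n ℝ, (∀ i j, 1 ≤ M i j * N i j) ∧ c = gamma2 N}

/-- The sign matrix of a Boolean function, with entries `(-1) ^ f x y`. -/
def signMatrix {X : Type u} {Y : Type v} (f : X → Y → Bool) : Matrix X Y ℝ :=
  Matrix.of fun x y => if f x y then -1 else 1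

/-! Lower bound. A box has distribution (1 + (-1)^(a ⊕ b ⊕ pq)) / 4, which is an inner product of a
vector of Alice and a vector of Bob (`nonLocalBox_toReal`). Averaging over the returned bits along a
decision tree gives each player one vector, and the correlation of a deterministic protocol is the
inner product of the two. By the parallelogram law each box multiplies the bound on the squared norm
by at most 2 for Alice and 1 for Bob, however adaptive the tree is
(`LocalStrategy.sum_fourier_sq_le`). Mixtures of protocols preserve this, so the correlation matrix
has `gamma2` at most √(2^t). Error ε puts its signed entries in [1 - 2ε, 1]; scaling by α makes it a
candidate for `gamma2Approx`.

Upper bound. A form of Grothendieck's inequality approximates any matrix of inner products of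
vectors of norm at most 1 by 8 times a convex combination of rank-one sign matrices
(`exists_mem_signHull_abs_sub_le`). A near-optimal matrix for Γ = γ₂^∞(f) thus yields a protocol
without boxes whose XOR has bias of order 1/Γ towards f. By Chebyshev, the majority of O(Γ²/ε)
independent repetitions is correct with probability 1 - ε (`one_sub_le_sum_weights_pos`). Each
repetition leaves an XOR-shared bit, and a tree of adders computes the majority of n such bits with
O(n) boxes (`exists_majority_strategies`). -/

/-! ### Factorization of the correlations of a protocol -/

theorem Fintype.card_mul_sum_eq_sum_update {ι β : Type*} [Fintype ι] [DecidableEq ι] [Fintype β]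
    (i : ι) (φ : (ι → β) → ℝ) :
    (Fintype.card β : ℝ) * ∑ a, φ a = ∑ a, ∑ c, φ (Function.update a i c) := by
  -- Exchanging the coordinate at `i` with the fresh value is an involution on pairs, so it can
  -- reindex the double sum.
  have hinv : Function.Involutive
      (fun q : (ι → β) × β => (Function.update q.1 i q.2, q.1 i)) := by
    rintro ⟨a, c⟩
    simp
  rw [← Fintype.sum_prod_type' (fun a c => φ (Function.update a i c)),
    ← Equiv.sum_comp hinv.toPerm, Fintype.sum_prod_type]
  simp [Function.Involutive.toPerm, Finset.mul_sum]

/-- The sign `(-1) ^ b`. -/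
def boolSign (b : Bool) : ℝ := if b then -1 else 1

theorem boolSign_xor (a b : Bool) : boolSign (xor a b) = boolSign a * boolSign b := by
  cases a <;> cases b <;> simp [boolSign]

theorem boolSign_sq (a : Bool) : boolSign a ^ 2 = 1 := by
  cases a <;> simp [boolSign]

/-- One player's vector in a factorization of the box distribution, for the input `p` and the
returned bit `c`; the kernel `h` factors the matrix `(-1) ^ (p ∧ q)`. -/
def boxVec (h : Bool → Bool → ℝ) (p c : Bool) : Option Bool → ℝ
  | none => 1
  | some k => boolSign c * h p k

theorem sum_boxVec (h : Bool → Bool → ℝ) (p : Bool) (k : Option Bool) :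
    ∑ c, boxVec h p c k = 2 * if k = none then 1 else 0 := by
  cases k with
  | none => norm_num [boxVec]
  | some k => simp [boxVec, boolSign]

/-- The kernel of Alice. -/
def hadamardKernel (p k : Bool) : ℝ := boolSign (p && k)

/-- The kernel of Bob. -/
def deltaKernel (q k : Bool) : ℝ := if q = k then 1 else 0

/-- The entry `none` gives the constant term and the two entries `some k` give (-1)^(p ∧ q).
Factoring that sign matrix as Hadamard times identity makes the squared row norms 2 for Alice and 1
for Bob. -/
theorem nonLocalBox_toReal (p q a b : Bool) :
    (nonLocalBox p q a b).toReal =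
      (∑ k, boxVec hadamardKernel p a k * boxVec deltaKernel q b k) / 4 := by
  cases p <;> cases q <;> cases a <;> cases b <;>
    norm_num [nonLocalBox, Fintype.sum_option, boxVec, hadamardKernel, deltaKernel, boolSign]

namespace LocalStrategy

variable {t : ℕ}

theorem input_congr {S : Finset (Fin t)} (s : LocalStrategy S) {a a' : Fin t → Bool}
    (h : ∀ i ∈ S, a i = a' i) : s.input a = s.input a' := by
  induction s with
  | halt out => rfl
  | use i hi p next ih =>
    funext j
    simp only [input]
    rw [← h i hi, ih (a i) fun k hk => h k (Finset.mem_of_mem_erase hk)]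

theorem output_congr {S : Finset (Fin t)} (s : LocalStrategy S) {a a' : Fin t → Bool}
    (h : ∀ i ∈ S, a i = a' i) : s.output a = s.output a' := by
  induction s with
  | halt out => rfl
  | use i hi p next ih =>
    simp only [output]
    rw [← h i hi, ih (a i) fun k hk => h k (Finset.mem_of_mem_erase hk)]

/-- The vector of a strategy in the factorization of the correlations, where `g` is a real-valued
function of the output bit. -/
noncomputable def fourier (h : Bool → Bool → ℝ) (g : Bool → ℝ) :
    {S : Finset (Fin t)} → LocalStrategy S → (Fin t → Option Bool) → ℝ
  | S, halt out, κ => g out * ∏ i ∈ S, if κ i = none then 1 else 0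
  | _, use i _ p next, κ => (∑ c, boxVec h p c (κ i) * (next c).fourier h g κ) / 2

theorem fourier_congr (h : Bool → Bool → ℝ) (g : Bool → ℝ) {S : Finset (Fin t)}
    (s : LocalStrategy S) {κ κ' : Fin t → Option Bool} (hκ : ∀ i ∈ S, κ i = κ' i) :
    s.fourier h g κ = s.fourier h g κ' := by
  induction s with
  | halt out =>
    simp only [fourier]
    rw [Finset.prod_congr rfl fun i hi => by rw [hκ i hi]]
  | use i hi p next ih =>
    simp only [fourier]
    rw [hκ i hi]
    congr 1
    exact Finset.sum_congr rfl fun c _ => by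
      rw [ih c fun k hk => hκ k (Finset.mem_of_mem_erase hk)]

/-- A bit from a box outside `S` is free and contributes a factor 2, so the normalization is 2^t for
every `S`. A box of `S` left unused gets input 0, and summing over its bit leaves only `κ i = none`,
as in the `halt` case of `fourier`. -/
theorem sum_prod_boxVec (h : Bool → Bool → ℝ) (g : Bool → ℝ) {S : Finset (Fin t)}
    (s : LocalStrategy S) (κ : Fin t → Option Bool) :
    ∑ a, g (s.output a) * ∏ i ∈ S, boxVec h (s.input a i) (a i) (κ i) =
      2 ^ t * s.fourier h g κ := by
  induction s with
  | @halt S out =>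
    simp only [output, input, fourier]
    rw [← Finset.mul_sum, mul_left_comm]
    congr 1
    have h1 : ∀ a : Fin t → Bool, ∏ i ∈ S, boxVec h false (a i) (κ i) =
        ∏ i, if i ∈ S then boxVec h false (a i) (κ i) else 1 := fun a => by
      rw [Finset.prod_ite_mem, Finset.univ_inter]
    simp only [h1]
    rw [← Fintype.piFinset_univ, ← Finset.prod_univ_sum (fun _ => Finset.univ)
      (fun i c => if i ∈ S then boxVec h false c (κ i) else 1)]
    have h2 : (2 : ℝ) ^ t = ∏ _i : Fin t, 2 := by simp
    have h3 : (∏ i ∈ S, if κ i = none then (1 : ℝ) else 0) =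
        ∏ i, if i ∈ S then (if κ i = none then (1 : ℝ) else 0) else 1 := by
      rw [Finset.prod_ite_mem, Finset.univ_inter]
    rw [h2, h3, ← Finset.prod_mul_distrib]
    refine Finset.prod_congr rfl fun i _ => ?_
    by_cases hi : i ∈ S
    · simp only [hi, if_true, sum_boxVec]
    · norm_num [hi]
  | @use S i hi p next ih =>
    -- Resampling the bit of box `i` separates it from the continuation, which depends only on bits
    -- of `S.erase i`.
    have key := Fintype.card_mul_sum_eq_sum_update i (fun a : Fin t → Bool =>
      g ((use i hi p next).output a) *
        ∏ j ∈ S, boxVec h ((use i hi p next).input a j) (a j) (κ j))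
    have hupd : ∀ (a : Fin t → Bool) (c : Bool), ∀ j ∈ S.erase i, Function.update a i c j = a j :=
      fun a c j hj => Function.update_of_ne (Finset.ne_of_mem_erase hj) _ _
    have hval : ∀ (a : Fin t → Bool) (c : Bool),
        g ((use i hi p next).output (Function.update a i c)) *
          ∏ j ∈ S, boxVec h ((use i hi p next).input (Function.update a i c) j)
            (Function.update a i c j) (κ j) =
        boxVec h p c (κ i) * (g ((next c).output a) *
          ∏ j ∈ S.erase i, boxVec h ((next c).input a j) (a j) (κ j)) := by
      intro a c
      rw [← Finset.mul_prod_erase S _ hi, mul_left_comm]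
      simp only [input, output, Function.update_self, if_true]
      rw [output_congr (next c) (hupd a c)]
      congr 2
      refine Finset.prod_congr rfl fun j hj => ?_
      rw [if_neg (Finset.ne_of_mem_erase hj), input_congr (next c) (hupd a c), hupd a c j hj]
    simp only [hval] at key
    rw [Finset.sum_comm] at key
    simp only [← Finset.mul_sum, ih] at key
    simp only [Fintype.card_bool, Nat.cast_ofNat] at key
    simp only [fourier]
    have : ∀ c, boxVec h p c (κ i) * (2 ^ t * (next c).fourier h g κ) =
      2 ^ t * (boxVec h p c (κ i) * (next c).fourier h g κ) := fun c => by ring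
    simp only [this, ← Finset.mul_sum] at key
    linarith

/-- Each coordinate of `κ` outside `S` is free and contributes a factor 3; the powers of 3 cancel
these, so the content is a bound `B ^ S.card` over the coordinates in `S`. -/
theorem sum_fourier_sq_le_aux (h : Bool → Bool → ℝ) (g : Bool → ℝ) {B : ℝ} (hB : 1 ≤ B)
    (hh : ∀ p, ∑ k, h p k ^ 2 ≤ B) (hg : ∀ b, g b ^ 2 ≤ 1) {S : Finset (Fin t)}
    (s : LocalStrategy S) :
    3 ^ S.card * ∑ κ, s.fourier h g κ ^ 2 ≤ 3 ^ t * B ^ S.card := by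
  induction s with
  | @halt S out =>
    have h1 : ∀ κ : Fin t → Option Bool, (halt out : LocalStrategy S).fourier h g κ ^ 2 =
        g out ^ 2 * ∏ i, if i ∈ S then (if κ i = none then (1 : ℝ) else 0) else 1 := by
      intro κ
      rw [Finset.prod_ite_mem, Finset.univ_inter, fourier, mul_pow, ← Finset.prod_pow]
      simp
    simp only [h1]
    rw [← Finset.mul_sum, ← Fintype.piFinset_univ, ← Finset.prod_univ_sum (fun _ => Finset.univ)
      (fun i c => if i ∈ S then (if c = none then (1 : ℝ) else 0) else 1)]
    have h2 : (3 : ℝ) ^ S.card = ∏ i : Fin t, if i ∈ S then 3 else 1 := by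
      rw [Finset.prod_ite_mem, Finset.univ_inter, Finset.prod_const]
    have h3 : (3 : ℝ) ^ t = ∏ _i : Fin t, 3 := by simp
    rw [h2, mul_left_comm, ← Finset.prod_mul_distrib, h3, mul_comm]
    refine mul_le_mul (le_of_eq (Finset.prod_congr rfl fun i _ => ?_))
      ((hg out).trans (one_le_pow₀ hB)) (sq_nonneg _) (by simp)
    by_cases hi : i ∈ S <;> norm_num [hi, Fintype.sum_option]
  | @use S i hi p next ih =>
    have key := Fintype.card_mul_sum_eq_sum_update i (fun κ : Fin t → Option Bool =>
      (use i hi p next).fourier h g κ ^ 2)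
    have hval : ∀ (κ : Fin t → Option Bool),
        ∑ k, (use i hi p next).fourier h g (Function.update κ i k) ^ 2 ≤
          B / 2 * ∑ c, (next c).fourier h g κ ^ 2 := by
      intro κ
      have hc : ∀ k c, (next c).fourier h g (Function.update κ i k) = (next c).fourier h g κ :=
        fun k c => fourier_congr h g _ fun j hj =>
          Function.update_of_ne (Finset.ne_of_mem_erase hj) _ _
      have hp := hh p
      simp only [fourier, Function.update_self, hc, Fintype.sum_option, Fintype.sum_bool, boxVec,
        boolSign] at hp ⊢
      generalize (next true).fourier h g κ = F₁
      generalize (next false).fourier h g κ = F₀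
      simp only [if_true, Bool.false_eq_true, if_false]
      -- The left side is ((F₁ + F₀)² + ∑ h² (F₁ - F₀)²) / 4; bounding both weights 1 and ∑ h² by
      -- `B` leaves the parallelogram law.
      nlinarith [mul_nonneg (sub_nonneg.2 hp) (sq_nonneg (F₁ - F₀)),
        mul_nonneg (sub_nonneg.2 hB) (sq_nonneg (F₁ + F₀))]
    have hsum := Finset.sum_le_sum fun κ (_ : κ ∈ Finset.univ) => hval κ
    rw [← key, ← Finset.mul_sum, Finset.sum_comm] at hsum
    simp only [Fintype.card_option, Fintype.card_bool, Fintype.sum_bool] at hsum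
    have hcard : S.card = (S.erase i).card + 1 := (Finset.card_erase_add_one hi).symm
    have ih1 := ih true
    have ih0 := ih false
    rw [hcard, pow_succ, pow_succ]
    have h3 : (0 : ℝ) ≤ 3 ^ (S.erase i).card := by positivity
    have h4 := mul_le_mul_of_nonneg_left hsum h3
    have h5 := mul_le_mul_of_nonneg_left (add_le_add ih1 ih0) (by linarith : 0 ≤ B / 2)
    push_cast at h4
    linarith

theorem sum_fourier_sq_le (h : Bool → Bool → ℝ) (g : Bool → ℝ) {B : ℝ} (hB : 1 ≤ B)
    (hh : ∀ p, ∑ k, h p k ^ 2 ≤ B) (hg : ∀ b, g b ^ 2 ≤ 1)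
    (s : LocalStrategy (Finset.univ : Finset (Fin t))) :
    ∑ κ, s.fourier h g κ ^ 2 ≤ B ^ t := by
  have := sum_fourier_sq_le_aux h g hB hh hg s
  rw [Finset.card_univ, Fintype.card_fin] at this
  exact le_of_mul_le_mul_left this (by positivity)

theorem fourier_one (h : Bool → Bool → ℝ) {S : Finset (Fin t)} (s : LocalStrategy S)
    (κ : Fin t → Option Bool) :
    s.fourier h (fun _ => 1) κ = ∏ i ∈ S, if κ i = none then 1 else 0 := by
  induction s with
  | halt out => simp [fourier]
  | @use S i hi p next ih =>
    simp only [fourier, ih]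
    rw [← Finset.mul_prod_erase S _ hi, ← Finset.sum_mul, sum_boxVec]
    ring

end LocalStrategy

namespace DetProtocol

variable {X : Type u} {Y : Type v} {t : ℕ}

/-- Each player's inputs depend only on his own returned bits, so once every box is factored, the
sums over `a` and `b` separate for each `κ`. -/
theorem sum_boxProb (P : DetProtocol X Y t) (x : X) (y : Y) (g g' : Bool → ℝ) :
    ∑ a, ∑ b, g ((P.alice x).output a) * g' ((P.bob y).output b) * (P.boxProb x y a b).toReal =
      ∑ κ, (P.alice x).fourier hadamardKernel g κ * (P.bob y).fourier deltaKernel g' κ := by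
  have h4 : (4 : ℝ) ^ t = 2 ^ t * 2 ^ t := by rw [← mul_pow]; norm_num
  have hbox : ∀ a b, (P.boxProb x y a b).toReal =
      (∑ κ : Fin t → Option Bool,
        (∏ i, boxVec hadamardKernel ((P.alice x).input a i) (a i) (κ i)) *
          ∏ i, boxVec deltaKernel ((P.bob y).input b i) (b i) (κ i)) / 4 ^ t := by
    intro a b
    rw [boxProb, ENNReal.toReal_prod]
    simp only [nonLocalBox_toReal, Finset.prod_div_distrib, ← Finset.prod_mul_distrib]
    rw [Finset.prod_univ_sum, Fintype.piFinset_univ]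
    simp
  have hA := LocalStrategy.sum_prod_boxVec hadamardKernel g (P.alice x)
  have hB := LocalStrategy.sum_prod_boxVec deltaKernel g' (P.bob y)
  have hR : ∀ κ, (P.alice x).fourier hadamardKernel g κ * (P.bob y).fourier deltaKernel g' κ =
      (2 ^ t * (P.alice x).fourier hadamardKernel g κ) *
        (2 ^ t * (P.bob y).fourier deltaKernel g' κ) / 4 ^ t := by
    intro κ
    rw [h4]
    field_simp
  simp only [hR, ← hA, ← hB, hbox, Finset.sum_mul_sum]
  rw [← Finset.sum_div]
  simp only [mul_div_assoc', ← Finset.sum_div, Finset.mul_sum]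
  congr 1
  conv_rhs => rw [Finset.sum_comm]; enter [2, a]; rw [Finset.sum_comm]
  exact Finset.sum_congr rfl fun a _ => Finset.sum_congr rfl fun b _ =>
    Finset.sum_congr rfl fun κ _ => by ring

theorem sum_boxProb_eq_one (P : DetProtocol X Y t) (x : X) (y : Y) :
    ∑ a, ∑ b, (P.boxProb x y a b).toReal = 1 := by
  have h := P.sum_boxProb x y (fun _ => 1) (fun _ => 1)
  simp only [one_mul, LocalStrategy.fourier_one, ← Finset.prod_mul_distrib] at h
  rw [h, ← Fintype.piFinset_univ, ← Finset.prod_univ_sum (fun _ => Finset.univ)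
    (fun (_ : Fin t) (c : Option Bool) => (if c = none then (1 : ℝ) else 0) * if c = none then 1 else 0)]
  simp

theorem boxProb_ne_top (P : DetProtocol X Y t) (x : X) (y : Y) (a b : Fin t → Bool) :
    P.boxProb x y a b ≠ ⊤ := by
  refine ENNReal.prod_ne_top fun i _ => ?_
  unfold nonLocalBox
  split_ifs <;> simp

/-- The expectation of `(-1) ^ (A ⊕ B)` on inputs `x` and `y`. -/
noncomputable def correlation (P : DetProtocol X Y t) (x : X) (y : Y) : ℝ :=
  ∑ κ, (P.alice x).fourier hadamardKernel boolSign κ * (P.bob y).fourier deltaKernel boolSign κ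

theorem successProb_ne_top (P : DetProtocol X Y t) (f : X → Y → Bool) (x : X) (y : Y) :
    P.successProb f x y ≠ ⊤ := by
  unfold successProb
  refine ENNReal.sum_ne_top.2 fun a _ => ENNReal.sum_ne_top.2 fun b _ => ?_
  split_ifs
  · exact P.boxProb_ne_top x y a b
  · simp

theorem successProb_toReal (P : DetProtocol X Y t) (f : X → Y → Bool) (x : X) (y : Y) :
    (P.successProb f x y).toReal = (1 + signMatrix f x y * P.correlation x y) / 2 := by
  have hne : ∀ a b, (if xor ((P.alice x).output a) ((P.bob y).output b) = f x y
      then P.boxProb x y a b else 0) ≠ ⊤ := by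
    intro a b
    split_ifs
    · exact P.boxProb_ne_top x y a b
    · simp
  unfold successProb correlation
  rw [ENNReal.toReal_sum fun a _ => ENNReal.sum_ne_top.2 fun b _ => hne a b]
  simp only [ENNReal.toReal_sum fun b _ => hne _ b]
  rw [← P.sum_boxProb, ← P.sum_boxProb_eq_one x y, Finset.mul_sum, ← Finset.sum_add_distrib,
    Finset.sum_div]
  refine Finset.sum_congr rfl fun a _ => ?_
  rw [Finset.mul_sum, ← Finset.sum_add_distrib, Finset.sum_div]
  refine Finset.sum_congr rfl fun b _ => ?_
  cases (P.alice x).output a <;> cases (P.bob y).output b <;> cases hf : f x y <;>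
    simp [signMatrix, boolSign, hf]

theorem successProb_eq_one (P : DetProtocol X Y t) (f : X → Y → Bool) (x : X) (y : Y)
    (h : ∀ a b, P.boxProb x y a b ≠ 0 →
      xor ((P.alice x).output a) ((P.bob y).output b) = f x y) :
    P.successProb f x y = 1 := by
  have h1 : P.successProb f x y = ∑ a, ∑ b, P.boxProb x y a b := by
    unfold successProb
    refine Finset.sum_congr rfl fun a _ => Finset.sum_congr rfl fun b _ => ?_
    split_ifs with hc
    · rfl
    · by_contra hne
      exact hc (h a b (Ne.symm hne))
  rw [← ENNReal.toReal_eq_one_iff, h1, ENNReal.toReal_sum fun a _ => ENNReal.sum_ne_top.2 fun b _ =>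
    P.boxProb_ne_top x y a b]
  simp only [ENNReal.toReal_sum fun b _ => P.boxProb_ne_top x y _ b]
  exact P.sum_boxProb_eq_one x y

end DetProtocol

/-! ### Elementary bounds for the factorization norms -/

theorem le_maxColNorm {k n : Type*} [Fintype k] [Finite n] (N : Matrix k n ℝ) (j : n) :
    √(∑ i, N i j ^ 2) ≤ maxColNorm N :=
  le_ciSup (f := fun j => √(∑ i, N i j ^ 2)) (Set.finite_range _).bddAbove j

theorem maxColNorm_nonneg {k n : Type*} [Fintype k] (N : Matrix k n ℝ) : 0 ≤ maxColNorm N :=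
  Real.iSup_nonneg fun _ => Real.sqrt_nonneg _

theorem sum_sq_le_maxColNorm_sq {k n : Type*} [Fintype k] [Finite n] (N : Matrix k n ℝ) (j : n) :
    ∑ i, N i j ^ 2 ≤ maxColNorm N ^ 2 :=
  (Real.sqrt_le_left (maxColNorm_nonneg N)).1 (le_maxColNorm N j)

theorem gamma2_nonneg {m n : Type*} (M : Matrix m n ℝ) : 0 ≤ gamma2 M := by
  refine Real.sInf_nonneg ?_
  rintro _ ⟨k, U, V, -, rfl⟩
  exact mul_nonneg (maxColNorm_nonneg U) (maxColNorm_nonneg V)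

theorem gamma2_le {m n ι : Type*} [Fintype ι] (M : Matrix m n ℝ) (u : m → ι → ℝ) (v : n → ι → ℝ)
    (hM : ∀ x y, M x y = ∑ i, u x i * v y i) {a b : ℝ}
    (hu : ∀ x, ∑ i, u x i ^ 2 ≤ a) (hv : ∀ y, ∑ i, v y i ^ 2 ≤ b) :
    gamma2 M ≤ √a * √b := by
  let e := Fintype.equivFin ι
  let U : Matrix (Fin (Fintype.card ι)) m ℝ := Matrix.of fun i x => u x (e.symm i)
  let V : Matrix (Fin (Fintype.card ι)) n ℝ := Matrix.of fun i y => v y (e.symm i)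
  have hU : maxColNorm U ≤ √a := Real.iSup_le (fun x => Real.sqrt_le_sqrt (by
    simpa [U, Equiv.sum_comp e.symm (fun i => u x i ^ 2)] using hu x)) (Real.sqrt_nonneg a)
  have hV : maxColNorm V ≤ √b := Real.iSup_le (fun y => Real.sqrt_le_sqrt (by
    simpa [V, Equiv.sum_comp e.symm (fun i => v y i ^ 2)] using hv y)) (Real.sqrt_nonneg b)
  refine le_trans (csInf_le ?_ ⟨_, U, V, ?_, rfl⟩)
    (mul_le_mul hU hV (maxColNorm_nonneg V) (Real.sqrt_nonneg a))
  · refine ⟨0, ?_⟩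
    rintro _ ⟨k, U, V, -, rfl⟩
    exact mul_nonneg (maxColNorm_nonneg U) (maxColNorm_nonneg V)
  · ext x y
    simp [U, V, Matrix.mul_apply, hM, Equiv.sum_comp e.symm (fun i => u x i * v y i)]

theorem gamma2Approx_le {m n : Type*} (α : ℝ) (M N : Matrix m n ℝ)
    (h : ∀ i j, 1 ≤ M i j * N i j ∧ M i j * N i j ≤ α) : gamma2Approx α M ≤ gamma2 N := by
  refine csInf_le ⟨0, ?_⟩ ⟨N, h, rfl⟩
  rintro _ ⟨N, -, rfl⟩
  exact gamma2_nonneg N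

theorem gamma2Approx_nonneg {m n : Type*} (α : ℝ) (M : Matrix m n ℝ) : 0 ≤ gamma2Approx α M := by
  refine Real.sInf_nonneg ?_
  rintro _ ⟨N, -, rfl⟩
  exact gamma2_nonneg N

theorem signMatrix_mul_self {X : Type u} {Y : Type v} (f : X → Y → Bool) (x : X) (y : Y) :
    signMatrix f x y * signMatrix f x y = 1 := by
  cases hf : f x y <;> simp [signMatrix, hf]

/-! ### The lower bound -/

instance LocalStrategy.instFinite {t : ℕ} (S : Finset (Fin t)) : Finite (LocalStrategy S) := by
  induction S using Finset.strongInduction with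
  | H S ih =>
    have h : ∀ i : {i // i ∈ S}, Finite (Bool × (Bool → LocalStrategy (S.erase i.1))) := fun i => by
      have := ih _ (Finset.erase_ssubset i.2)
      infer_instance
    let F : LocalStrategy S →
        Bool ⊕ (Σ i : {i // i ∈ S}, Bool × (Bool → LocalStrategy (S.erase i.1))) := fun s =>
      match s with
      | .halt out => Sum.inl out
      | .use i hi p next => Sum.inr ⟨⟨i, hi⟩, p, next⟩
    refine Finite.of_injective F ?_
    intro s s' hs
    cases s <;> cases s' <;> simp only [F, Sum.inl.injEq, Sum.inr.injEq, reduceCtorEq] at hs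
    · rw [hs]
    · cases hs
      rfl

instance DetProtocol.instFinite {X : Type u} {Y : Type v} [Finite X] [Finite Y] (t : ℕ) :
    Finite (DetProtocol X Y t) :=
  Finite.of_injective (fun P : DetProtocol X Y t => (P.alice, P.bob)) fun P Q h => by
    cases P
    cases Q
    simpa using h

/-- The vectors of all protocols are concatenated with weights `√(w P)` on both sides, so squared
norms are averaged; the factor `c` is put on Alice's side. -/
theorem DetProtocol.gamma2_mixture_le {X : Type u} {Y : Type v} {t : ℕ}
    [Fintype (DetProtocol X Y t)] (w : DetProtocol X Y t → ℝ) (hw : ∀ P, 0 ≤ w P)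
    (hw1 : ∑ P, w P = 1) {c : ℝ} (hc : 0 ≤ c) :
    gamma2 (Matrix.of fun x y => c * ∑ P, w P * P.correlation x y) ≤ c * √(2 ^ t) := by
  have hh : ∀ p, ∑ k, hadamardKernel p k ^ 2 ≤ 2 := fun p => by
    simp [hadamardKernel, boolSign_sq]
  have hd : ∀ p, ∑ k, deltaKernel p k ^ 2 ≤ 1 := fun p => by
    cases p <;> simp [deltaKernel]
  have hs : ∀ b, boolSign b ^ 2 ≤ 1 := fun b => (boolSign_sq b).le
  have := gamma2_le (ι := DetProtocol X Y t × (Fin t → Option Bool))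
    (Matrix.of fun x y => c * ∑ P, w P * P.correlation x y)
    (fun x q => (c * √(w q.1)) * (q.1.alice x).fourier hadamardKernel boolSign q.2)
    (fun y q => √(w q.1) * (q.1.bob y).fourier deltaKernel boolSign q.2)
    (a := c ^ 2 * 2 ^ t) (b := 1) ?_ ?_ ?_
  · rwa [Real.sqrt_mul (sq_nonneg c), Real.sqrt_sq hc, Real.sqrt_one, mul_one] at this
  · intro x y
    rw [Fintype.sum_prod_type, Matrix.of_apply, Finset.mul_sum]
    refine Finset.sum_congr rfl fun P _ => ?_
    rw [correlation, ← mul_assoc, Finset.mul_sum]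
    refine Finset.sum_congr rfl fun κ _ => ?_
    nth_rewrite 1 [← Real.mul_self_sqrt (hw P)]
    ring
  · intro x
    rw [Fintype.sum_prod_type]
    simp only [mul_pow, Real.sq_sqrt (hw _)]
    calc ∑ P, ∑ κ, c ^ 2 * w P * (P.alice x).fourier hadamardKernel boolSign κ ^ 2
        ≤ ∑ P, c ^ 2 * w P * 2 ^ t := Finset.sum_le_sum fun P _ => by
          rw [← Finset.mul_sum]
          exact mul_le_mul_of_nonneg_left
            (LocalStrategy.sum_fourier_sq_le _ _ one_le_two hh hs _)
            (mul_nonneg (sq_nonneg c) (hw P))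
      _ = c ^ 2 * 2 ^ t := by rw [← Finset.sum_mul, ← Finset.mul_sum, hw1, mul_one]
  · intro y
    rw [Fintype.sum_prod_type]
    simp only [mul_pow, Real.sq_sqrt (hw _)]
    calc ∑ P, ∑ κ, w P * (P.bob y).fourier deltaKernel boolSign κ ^ 2
        ≤ ∑ P, w P * 1 := Finset.sum_le_sum fun P _ => by
          rw [← Finset.mul_sum]
          have := LocalStrategy.sum_fourier_sq_le _ _ le_rfl hd hs (P.bob y)
          rw [one_pow] at this
          exact mul_le_mul_of_nonneg_left this (hw P)
      _ = 1 := by rw [← Finset.sum_mul, hw1, mul_one]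

theorem gamma2Approx_signMatrix_le {X : Type u} {Y : Type v} [Finite X] [Finite Y] {ε α : ℝ}
    (hε : ε < 1 / 2) (hα : α = 1 / (1 - 2 * ε)) (f : X → Y → Bool) {t : ℕ}
    (ht : NLComputable ε f t) : gamma2Approx α (signMatrix f) ≤ α * √(2 ^ t) := by
  have := Fintype.ofFinite (DetProtocol X Y t)
  obtain ⟨μ, hμ⟩ := ht
  have hpos : 0 < 1 - 2 * ε := by linarith
  have hα0 : 0 ≤ α := by rw [hα]; positivity
  have hsum : ∑ P, (μ P).toReal = 1 := by
    rw [← ENNReal.toReal_sum fun P _ => μ.apply_ne_top P, ← tsum_fintype (L := .unconditional _), μ.tsum_coe,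
      ENNReal.toReal_one]
  refine le_trans (gamma2Approx_le _ _ _ fun x y => ?_)
    (DetProtocol.gamma2_mixture_le (fun P => (μ P).toReal) (fun P => ENNReal.toReal_nonneg) hsum hα0)
  have hsucc : ∀ P : DetProtocol X Y t, (P.successProb f x y).toReal ≤ 1 := fun P => by
    refine ENNReal.toReal_le_of_le_ofReal zero_le_one ?_
    rw [← P.sum_boxProb_eq_one x y]
    simp only [← ENNReal.toReal_sum fun b _ => P.boxProb_ne_top x y _ b]
    rw [← ENNReal.toReal_sum fun a _ => ENNReal.sum_ne_top.2 fun b _ => P.boxProb_ne_top x y a b,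
      ENNReal.ofReal_toReal (ENNReal.sum_ne_top.2 fun a _ => ENNReal.sum_ne_top.2 fun b _ =>
        P.boxProb_ne_top x y a b)]
    refine Finset.sum_le_sum fun a _ => Finset.sum_le_sum fun b _ => ?_
    split_ifs
    · exact le_rfl
    · exact zero_le
  have h1 : 1 - ε ≤ ∑ P, (μ P).toReal * (P.successProb f x y).toReal := by
    have h := hμ x y
    rw [tsum_fintype] at h
    simp only [← ENNReal.toReal_mul]
    rw [← ENNReal.toReal_sum fun P _ =>
      ENNReal.mul_ne_top (μ.apply_ne_top P) (P.successProb_ne_top f x y)]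
    exact (ENNReal.ofReal_le_iff_le_toReal (ENNReal.sum_ne_top.2 fun P _ =>
      ENNReal.mul_ne_top (μ.apply_ne_top P) (P.successProb_ne_top f x y))).1 h
  have h2 : ∑ P, (μ P).toReal * (P.successProb f x y).toReal ≤ 1 := by
    rw [← hsum]
    exact Finset.sum_le_sum fun P _ => mul_le_of_le_one_right ENNReal.toReal_nonneg (hsucc P)
  have h3 : ∑ P, (μ P).toReal * (P.successProb f x y).toReal =
      (1 + signMatrix f x y * ∑ P, (μ P).toReal * P.correlation x y) / 2 := by
    rw [← hsum, Finset.mul_sum, ← Finset.sum_add_distrib, Finset.sum_div]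
    refine Finset.sum_congr rfl fun P _ => ?_
    rw [P.successProb_toReal]
    ring
  rw [h3] at h1 h2
  rw [Matrix.of_apply, mul_left_comm]
  have hα1 : α * (1 - 2 * ε) = 1 := by rw [hα]; field_simp
  constructor
  · rw [← hα1]
    exact mul_le_mul_of_nonneg_left (by linarith) hα0
  · exact mul_le_of_le_one_right hα0 (by linarith)

theorem two_mul_logb_gamma2Approx_le_NL {X : Type u} {Y : Type v} [Fintype X] [Fintype Y] {ε α : ℝ}
    (hε0 : 0 ≤ ε) (hε : ε < 1 / 2) (hα : α = 1 / (1 - 2 * ε)) (f : X → Y → Bool) :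
    2 * Real.logb 2 (gamma2Approx α (signMatrix f) / α) ≤ (NL ε f : ℝ) := by
  have hmem : NLComputable ε f (NL ε f) := Nat.sInf_mem (s := {t | NLComputable ε f t})
    ⟨_, exists_NLComputable hε0 f⟩
  have hle := gamma2Approx_signMatrix_le hε hα f hmem
  have hα0 : 0 < α := by
    rw [hα]
    exact one_div_pos.2 (by linarith)
  -- If the norm vanishes, the convention `logb 2 0 = 0` makes the bound trivial.
  rcases (gamma2Approx_nonneg α (signMatrix f)).eq_or_lt with h0 | h0
  · rw [← h0]
    simp
  · have h1 : gamma2Approx α (signMatrix f) / α ≤ √(2 ^ NL ε f) := by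
      rw [div_le_iff₀ hα0, mul_comm]
      exact hle
    have h2 := Real.logb_le_logb_of_le one_lt_two (div_pos h0 hα0) h1
    rw [Real.sqrt_eq_rpow, ← Real.rpow_natCast, ← Real.rpow_mul zero_le_two,
      Real.logb_rpow (by norm_num) (by norm_num)] at h2
    linarith

/-! ### Grothendieck's inequality by truncation -/

theorem sum_rademacher_mul {ι : Type*} [Fintype ι] [DecidableEq ι] (u v : ι → ℝ) (S : Finset ι) :
    ∑ e : ι → Bool, (∑ i ∈ S, u i * boolSign (e i)) * (∑ i ∈ S, v i * boolSign (e i)) =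
      Fintype.card (ι → Bool) * ∑ i ∈ S, u i * v i := by
  induction S using Finset.induction_on with
  | empty => simp
  | insert i S hi ih =>
    have key := Fintype.card_mul_sum_eq_sum_update i (fun e : ι → Bool =>
      (∑ i ∈ insert i S, u i * boolSign (e i)) * (∑ i ∈ insert i S, v i * boolSign (e i)))
    have hupd : ∀ (w : ι → ℝ) (e : ι → Bool) (c : Bool),
        ∑ j ∈ insert i S, w j * boolSign (Function.update e i c j) =
          w i * boolSign c + ∑ j ∈ S, w j * boolSign (e j) := by
      intro w e c
      rw [Finset.sum_insert hi, Function.update_self]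
      congr 1
      refine Finset.sum_congr rfl fun j hj => ?_
      rw [Function.update_of_ne (ne_of_mem_of_not_mem hj hi)]
    have hval : ∀ p q x y : ℝ, ∑ c, (p * boolSign c + x) * (q * boolSign c + y) =
        2 * (p * q) + 2 * (x * y) := by
      intro p q x y
      simp [boolSign]
      ring
    simp only [hupd, hval, Finset.sum_add_distrib, ← Finset.mul_sum, ih] at key
    rw [Finset.sum_insert hi]
    simp only [Finset.sum_const, Finset.card_univ, nsmul_eq_mul, Fintype.card_bool,
      Nat.cast_ofNat] at key
    linarith

/-- When a coordinate is added, odd powers of its sign cancel, and the cross term 6 u² x² is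
evaluated by the second moment; it is matched by 3 (u² + s)², with s the previous sum of squares. -/
theorem sum_rademacher_pow_four_le {ι : Type*} [Fintype ι] [DecidableEq ι] (u : ι → ℝ)
    (S : Finset ι) :
    ∑ e : ι → Bool, (∑ i ∈ S, u i * boolSign (e i)) ^ 4 ≤
      Fintype.card (ι → Bool) * (3 * (∑ i ∈ S, u i ^ 2) ^ 2) := by
  induction S using Finset.induction_on with
  | empty => simp
  | insert i S hi ih =>
    have key := Fintype.card_mul_sum_eq_sum_update i (fun e : ι → Bool =>
      (∑ i ∈ insert i S, u i * boolSign (e i)) ^ 4)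
    have hupd : ∀ (w : ι → ℝ) (e : ι → Bool) (c : Bool),
        ∑ j ∈ insert i S, w j * boolSign (Function.update e i c j) =
          w i * boolSign c + ∑ j ∈ S, w j * boolSign (e j) := by
      intro w e c
      rw [Finset.sum_insert hi, Function.update_self]
      congr 1
      refine Finset.sum_congr rfl fun j hj => ?_
      rw [Function.update_of_ne (ne_of_mem_of_not_mem hj hi)]
    have hval : ∀ p x : ℝ, ∑ c, (p * boolSign c + x) ^ 4 =
        2 * p ^ 4 + 12 * p ^ 2 * (x * x) + 2 * x ^ 4 := by
      intro p x
      simp [boolSign]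
      ring
    simp only [hupd, hval, Finset.sum_add_distrib, ← Finset.mul_sum, sum_rademacher_mul] at key
    rw [Finset.sum_insert hi]
    simp only [Finset.sum_const, Finset.card_univ, nsmul_eq_mul, Fintype.card_bool,
      Nat.cast_ofNat, ← pow_two] at key
    have h0 : (0 : ℝ) ≤ Fintype.card (ι → Bool) * u i ^ 4 := by positivity
    nlinarith

/-- Truncation of a real number to the interval `[-2, 2]`. -/
noncomputable def truncTwo (z : ℝ) : ℝ := max (-2) (min 2 z)

theorem abs_truncTwo_le (z : ℝ) : |truncTwo z| ≤ 2 :=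
  abs_le.2 ⟨le_max_left _ _, max_le (by norm_num) (min_le_left _ _)⟩

theorem truncTwo_sq_le (z : ℝ) : truncTwo z ^ 2 ≤ z ^ 2 := by
  unfold truncTwo
  rcases le_total 2 z with h | h
  · rw [min_eq_left h, max_eq_right (by norm_num)]
    nlinarith
  · rw [min_eq_right h]
    rcases le_total (-2) z with h' | h'
    · rw [max_eq_right h']
    · rw [max_eq_left h']
      nlinarith

/-- In absolute value the excess is at most z² / 8, since z - 2 ≤ z² / 8 amounts to (z - 4)² ≥ 0.
This lets fourth moments control the tail. -/
theorem sub_truncTwo_sq_le (z : ℝ) : (z - truncTwo z) ^ 2 ≤ z ^ 4 / 64 := by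
  have h64 : z ^ 4 / 64 = (z ^ 2 / 8) ^ 2 := by ring
  rw [h64]
  refine sq_le_sq' ?_ ?_ <;> unfold truncTwo <;> rcases le_total 2 z with h | h
  · rw [min_eq_left h, max_eq_right (by norm_num)]
    nlinarith
  · rw [min_eq_right h]
    rcases le_total (-2) z with h' | h'
    · rw [max_eq_right h']
      nlinarith
    · rw [max_eq_left h']
      nlinarith [sq_nonneg (z + 4)]
  · rw [min_eq_left h, max_eq_right (by norm_num)]
    nlinarith [sq_nonneg (z - 4)]
  · rw [min_eq_right h]
    rcases le_total (-2) z with h' | h'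
    · rw [max_eq_right h']
      nlinarith
    · rw [max_eq_left h']
      nlinarith

/-- The convex hull of the sign matrices of rank one. -/
def signHull (X : Type u) (Y : Type v) : Set (X → Y → ℝ) :=
  convexHull ℝ (Set.range fun p : (X → Bool) × (Y → Bool) =>
    fun x y => boolSign (p.1 x) * boolSign (p.2 y))

theorem mem_convexHull_range_boolSign {X : Type*} [Finite X] {F : X → ℝ} (hF : ∀ x, |F x| ≤ 1) :
    F ∈ convexHull ℝ (Set.range fun (s : X → Bool) x => boolSign (s x)) := by
  have hrange : (Set.range fun (s : X → Bool) x => boolSign (s x)) =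
      Set.univ.pi fun _ => {-1, 1} := by
    ext G
    constructor
    · rintro ⟨s, rfl⟩ x -
      cases hs : s x <;> simp [boolSign, hs]
    · intro hG
      refine ⟨fun x => decide (G x = -1), funext fun x => ?_⟩
      rcases hG x trivial with h | h
      · simp [boolSign, h]
      · rw [Set.mem_singleton_iff] at h
        norm_num [boolSign, h]
  rw [hrange, convexHull_pi]
  intro x _
  rw [convexHull_pair, segment_eq_Icc (by norm_num)]
  exact abs_le.1 (hF x)

/-- A function bounded by 1 is a mixture of sign functions; bilinearity allows this in one factor at
a time. -/
theorem mul_mem_signHull {X : Type u} {Y : Type v} [Finite X] [Finite Y] {F : X → ℝ} {G : Y → ℝ}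
    (hF : ∀ x, |F x| ≤ 1) (hG : ∀ y, |G y| ≤ 1) : (fun x y => F x * G y) ∈ signHull X Y := by
  let L : (X → ℝ) →ₗ[ℝ] (Y → ℝ) →ₗ[ℝ] (X → Y → ℝ) :=
    LinearMap.mk₂ ℝ (fun F G x y => F x * G y)
      (fun _ _ _ => by ext; simp [add_mul]) (fun _ _ _ => by ext; simp [mul_assoc])
      (fun _ _ _ => by ext; simp [mul_add]) (fun _ _ _ => by ext; simp [mul_left_comm])
  have hconv : Convex ℝ (signHull X Y) := convex_convexHull ℝ _
  have h1 : ∀ r : Y → Bool, L F (fun y => boolSign (r y)) ∈ signHull X Y := by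
    intro r
    refine convexHull_min (t := (L.flip fun y => boolSign (r y)) ⁻¹' signHull X Y) ?_
      (hconv.linear_preimage _) (mem_convexHull_range_boolSign hF)
    rintro _ ⟨s, rfl⟩
    exact subset_convexHull ℝ _ ⟨(s, r), rfl⟩
  refine convexHull_min (t := L F ⁻¹' signHull X Y) ?_
    (hconv.linear_preimage _) (mem_convexHull_range_boolSign hG)
  rintro _ ⟨r, rfl⟩
  exact h1 r

/-- With Rademacher sums f, g and truncation T, ⟨p, q⟩ = E[fg] and fg = Tf Tg + (f - Tf) Tg + f (g -
Tg). The first term averages to 4 times a point of the hull. The rest is half an inner product of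
new vectors of norm at most 1, to which induction applies. The constant 8 solves K = 4 + K / 2. -/
theorem exists_mem_signHull_abs_sub_le {X : Type u} {Y : Type v} [Finite X] [Finite Y] (m : ℕ) :
    ∀ {ι : Type} [Fintype ι] (p : X → ι → ℝ) (q : Y → ι → ℝ), (∀ x, ∑ i, p x i ^ 2 ≤ 1) →
      (∀ y, ∑ i, q y i ^ 2 ≤ 1) →
        ∃ C ∈ signHull X Y, ∀ x y, |∑ i, p x i * q y i - 8 * C x y| ≤ (1 / 2) ^ m := by
  classical
  induction m with
  | zero =>
    intro ι _ p q hp hq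
    refine ⟨fun x y => 0 * 0, mul_mem_signHull (by simp) (by simp), fun x y => ?_⟩
    simp only [mul_zero, sub_zero, pow_zero]
    rw [← sq_le_one_iff_abs_le_one]
    exact (Finset.sum_mul_sq_le_sq_mul_sq _ _ _).trans
      (mul_le_one₀ (hp x) (Finset.sum_nonneg fun _ _ => sq_nonneg _) (hq y))
  | succ m ih =>
    intro ι _ p q hp hq
    let n : ℝ := Fintype.card (ι → Bool)
    have hn : 0 < n := by simp [n]
    let σ : ℝ := √(1 / n)
    have hσ : σ ^ 2 = 1 / n := Real.sq_sqrt (by positivity)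
    have hσn : σ ^ 2 * n = 1 := by rw [hσ]; field_simp
    let f : X → (ι → Bool) → ℝ := fun x e => ∑ i, p x i * boolSign (e i)
    let g : Y → (ι → Bool) → ℝ := fun y e => ∑ i, q y i * boolSign (e i)
    have hfg : ∀ x y, ∑ e, f x e * g y e = n * ∑ i, p x i * q y i := fun x y =>
      sum_rademacher_mul (p x) (q y) Finset.univ
    have hsq : ∀ w : ι → ℝ, ∑ i, w i ^ 2 ≤ 1 →
        ∑ e : ι → Bool, (∑ i, w i * boolSign (e i)) ^ 2 ≤ n := by
      intro w hw
      have h := sum_rademacher_mul w w Finset.univ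
      simp only [← pow_two] at h
      rw [h]
      exact mul_le_of_le_one_right hn.le hw
    have htail : ∀ w : ι → ℝ, ∑ i, w i ^ 2 ≤ 1 → ∑ e : ι → Bool,
        (∑ i, w i * boolSign (e i) - truncTwo (∑ i, w i * boolSign (e i))) ^ 2 ≤ n * (3 / 64) := by
      intro w hw
      have h := sum_rademacher_pow_four_le w Finset.univ
      have h0 : (∑ i, w i ^ 2) ^ 2 ≤ 1 := pow_le_one₀ (Finset.sum_nonneg fun _ _ => sq_nonneg _) hw
      calc _ ≤ ∑ e : ι → Bool, (∑ i, w i * boolSign (e i)) ^ 4 / 64 :=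
            Finset.sum_le_sum fun e _ => sub_truncTwo_sq_le _
        _ ≤ n * (3 * (∑ i, w i ^ 2) ^ 2) / 64 := by
            rw [← Finset.sum_div]
            exact div_le_div_of_nonneg_right h (by norm_num)
        _ ≤ n * (3 / 64) := by nlinarith
    have htrunc : ∀ w : ι → ℝ, ∑ i, w i ^ 2 ≤ 1 →
        ∑ e : ι → Bool, truncTwo (∑ i, w i * boolSign (e i)) ^ 2 ≤ n := fun w hw =>
      (Finset.sum_le_sum fun e _ => truncTwo_sq_le _).trans (hsq w hw)
    -- The scalings 4σ and σ/2 multiply to 2σ², which gives the half, and bound the squared norms by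
    -- 16 · 3/64 + 1/4 = 1.
    obtain ⟨C', hC', herr⟩ := ih (ι := (ι → Bool) ⊕ (ι → Bool))
      (fun x => Sum.elim (fun e => 4 * σ * (f x e - truncTwo (f x e))) fun e => σ / 2 * f x e)
      (fun y => Sum.elim (fun e => σ / 2 * truncTwo (g y e))
        fun e => 4 * σ * (g y e - truncTwo (g y e)))
      (fun x => by
        simp only [Fintype.sum_sum_type, Sum.elim_inl, Sum.elim_inr, mul_pow, div_pow,
          ← Finset.mul_sum]
        have h1 := mul_le_mul_of_nonneg_left (htail _ (hp x)) (sq_nonneg σ)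
        have h2 := mul_le_mul_of_nonneg_left (hsq _ (hp x)) (sq_nonneg σ)
        simp only [f]
        nlinarith)
      (fun y => by
        simp only [Fintype.sum_sum_type, Sum.elim_inl, Sum.elim_inr, mul_pow, div_pow,
          ← Finset.mul_sum]
        have h1 := mul_le_mul_of_nonneg_left (htail _ (hq y)) (sq_nonneg σ)
        have h2 := mul_le_mul_of_nonneg_left (htrunc _ (hq y)) (sq_nonneg σ)
        simp only [g]
        nlinarith)
    have hconv : Convex ℝ (signHull X Y) := convex_convexHull ℝ _
    have hC₁ : (∑ e : ι → Bool, σ ^ 2 • fun x y => truncTwo (f x e) / 2 * (truncTwo (g y e) / 2)) ∈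
        signHull X Y := by
      refine hconv.sum_mem (fun _ _ => sq_nonneg σ) ?_ fun e _ =>
        mul_mem_signHull (fun x => ?_) (fun y => ?_)
      · rw [Finset.sum_const, Finset.card_univ, nsmul_eq_mul, mul_comm]
        exact hσn
      · rw [abs_div, abs_two]
        linarith [abs_truncTwo_le (f x e)]
      · rw [abs_div, abs_two]
        linarith [abs_truncTwo_le (g y e)]
    refine ⟨_, hconv hC₁ hC' (a := 1 / 2) (b := 1 / 2) (by norm_num) (by norm_num) (by norm_num),
      fun x y => ?_⟩
    have h := herr x y
    simp only [Fintype.sum_sum_type, Sum.elim_inl, Sum.elim_inr, ← Finset.sum_add_distrib] at h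
    have hN : ∑ i, p x i * q y i = σ ^ 2 * ∑ e, f x e * g y e := by
      rw [hfg, ← mul_assoc, hσn, one_mul]
    simp only [Pi.add_apply, Pi.smul_apply, Finset.sum_apply, smul_eq_mul]
    have hid : ∑ i, p x i * q y i - 8 * (1 / 2 * ∑ e : ι → Bool,
        σ ^ 2 * (truncTwo (f x e) / 2 * (truncTwo (g y e) / 2)) + 1 / 2 * C' x y) =
        1 / 2 * (∑ e : ι → Bool, (4 * σ * (f x e - truncTwo (f x e)) * (σ / 2 * truncTwo (g y e)) +
          σ / 2 * f x e * (4 * σ * (g y e - truncTwo (g y e)))) - 8 * C' x y) := by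
      have hexp : ∑ i, p x i * q y i = 4 * ∑ e : ι → Bool,
          σ ^ 2 * (truncTwo (f x e) / 2 * (truncTwo (g y e) / 2)) +
          1 / 2 * ∑ e : ι → Bool, (4 * σ * (f x e - truncTwo (f x e)) * (σ / 2 * truncTwo (g y e)) +
          σ / 2 * f x e * (4 * σ * (g y e - truncTwo (g y e)))) := by
        rw [hN, Finset.mul_sum, Finset.mul_sum, Finset.mul_sum, ← Finset.sum_add_distrib]
        exact Finset.sum_congr rfl fun e _ => by ring
      rw [hexp]
      ring
    rw [hid, abs_mul, abs_of_nonneg (by norm_num : (0 : ℝ) ≤ 1 / 2), pow_succ']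
    exact mul_le_mul_of_nonneg_left h (by norm_num)

/-! ### Majority of XOR-shared bits -/

/-- A non-adaptive order of boxes, the inputs of which may depend on the bits received from earlier
boxes. -/
theorem LocalStrategy.exists_causal {t : ℕ} (S : Finset (Fin t)) :
    ∀ (p : (Fin t → Bool) → Fin t → Bool) (out : (Fin t → Bool) → Bool),
      (∀ i ∈ S, ∀ a a', (∀ j ∈ S, j < i → a j = a' j) → p a i = p a' i) →
      (∀ a a', (∀ i ∈ S, a i = a' i) → out a = out a') →
      ∃ s : LocalStrategy S, (∀ a, ∀ j ∈ S, s.input a j = p a j) ∧ ∀ a, s.output a = out a := by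
  induction S using Finset.strongInduction with
  | H S ih =>
    intro p out hp hout
    rcases S.eq_empty_or_nonempty with rfl | hS
    · exact ⟨.halt (out fun _ => false), by simp, fun a => hout _ _ (by simp)⟩
    · let i := S.min' hS
      have hi : i ∈ S := S.min'_mem hS
      have hmin : ∀ j ∈ S, ¬ j < i := fun j hj => not_lt.2 (S.min'_le j hj)
      have key : ∀ c : Bool, ∃ s : LocalStrategy (S.erase i),
          (∀ a, ∀ j ∈ S.erase i, s.input a j = p (Function.update a i c) j) ∧
            ∀ a, s.output a = out (Function.update a i c) := by
        intro c
        refine ih _ (Finset.erase_ssubset hi) (fun a => p (Function.update a i c)) _ ?_ ?_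
        · intro k hk a a' h
          refine hp k (Finset.mem_of_mem_erase hk) _ _ fun j hj hjk => ?_
          by_cases hji : j = i
          · subst hji; simp
          · simp [Function.update_of_ne hji, h j (Finset.mem_erase.2 ⟨hji, hj⟩) hjk]
        · intro a a' h
          refine hout _ _ fun j hj => ?_
          by_cases hji : j = i
          · subst hji; simp
          · simp [Function.update_of_ne hji, h j (Finset.mem_erase.2 ⟨hji, hj⟩)]
      choose next h1 h2 using key
      -- No box of `S` precedes its minimum, so by causality the first input can be read off at an
      -- arbitrary assignment.
      refine ⟨.use i hi (p (fun _ => false) i) next, fun a j hj => ?_, fun a => ?_⟩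
      · by_cases hji : j = i
        · subst hji
          simp only [LocalStrategy.input, if_true]
          exact hp _ hj _ _ fun j hj hlt => absurd hlt (hmin j hj)
        · simp [LocalStrategy.input, hji, h1 (a i) a j (Finset.mem_erase.2 ⟨hji, hj⟩)]
      · simp [LocalStrategy.output, h2]

/-- A use of boxes `0, 1, …, size - 1`, in this order, by two players who hold the bits `s` and `r`
indexed by `ι`. -/
structure BoxWiring (ι : Type*) where
  size : ℕ
  alice : (ι → Bool) → (ℕ → Bool) → ℕ → Bool
  bob : (ι → Bool) → (ℕ → Bool) → ℕ → Bool
  alice_causal : ∀ s a a' i, (∀ j < i, a j = a' j) → alice s a i = alice s a' i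
  bob_causal : ∀ r b b' i, (∀ j < i, b j = b' j) → bob r b i = bob r b' i

namespace BoxWiring

variable {ι : Type*}

/-- The returned bits `a`, `b` have positive probability. -/
def Consistent (W : BoxWiring ι) (s r : ι → Bool) (a b : ℕ → Bool) : Prop :=
  ∀ i < W.size, xor (a i) (b i) = (W.alice s a i && W.bob r b i)

/-- After the use of the boxes, the players hold an XOR-sharing of the bit `g (s ⊕ r)`. -/
def Shares (W : BoxWiring ι) (g : (ι → Bool) → Bool) : Prop :=
  ∃ α β : (ι → Bool) → (ℕ → Bool) → Bool,
    (∀ s a a', (∀ j < W.size, a j = a' j) → α s a = α s a') ∧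
    (∀ r b b', (∀ j < W.size, b j = b' j) → β r b = β r b') ∧
    ∀ s r a b, W.Consistent s r a b → xor (α s a) (β r b) = g fun i => xor (s i) (r i)

theorem Shares.xor {W : BoxWiring ι} {g h : (ι → Bool) → Bool} (hg : W.Shares g)
    (hh : W.Shares h) : W.Shares fun z => xor (g z) (h z) := by
  obtain ⟨α, β, hα, hβ, hs⟩ := hg
  obtain ⟨α', β', hα', hβ', hs'⟩ := hh
  refine ⟨fun s a => Bool.xor (α s a) (α' s a), fun r b => Bool.xor (β r b) (β' r b), ?_, ?_, ?_⟩
  · intro s a a' h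
    simp only [hα s a a' h, hα' s a a' h]
  · intro r b b' h
    simp only [hβ r b b' h, hβ' r b b' h]
  · intro s r a b hc
    simp only [← hs s r a b hc, ← hs' s r a b hc]
    cases α s a <;> cases α' s a <;> cases β r b <;> cases β' r b <;> rfl

/-- The wiring without boxes. -/
def nil (ι : Type*) : BoxWiring ι where
  size := 0
  alice _ _ _ := false
  bob _ _ _ := false
  alice_causal _ _ _ _ _ := rfl
  bob_causal _ _ _ _ _ := rfl

theorem nil_shares_apply (i : ι) : (nil ι).Shares fun z => z i :=
  ⟨fun s _ => s i, fun r _ => r i, fun _ _ _ _ => rfl, fun _ _ _ _ => rfl, fun _ _ _ _ _ => rfl⟩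

theorem shares_false (W : BoxWiring ι) : W.Shares fun _ => false :=
  ⟨fun _ _ => false, fun _ _ => false, fun _ _ _ _ => rfl, fun _ _ _ _ => rfl,
    fun _ _ _ _ _ => rfl⟩

/-- In (p ⊕ q)(p' ⊕ q') the products pp' and qq' are local, and each of the two cross terms is
XOR-shared by one box. -/
theorem and_shared_identity (p p' q q' a b a' b' : Bool) (h : xor a b = (p && q'))
    (h' : xor a' b' = (p' && q)) :
    xor (xor (p && p') (xor a a')) (xor (q && q') (xor b b')) = (xor p q && xor p' q') := by
  revert p p' q q' a b a' b'
  decide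

/-- The conjunction of two shared bits takes two boxes. -/
theorem exists_and (W : BoxWiring ι) {g h : (ι → Bool) → Bool} (hg : W.Shares g)
    (hh : W.Shares h) : ∃ W' : BoxWiring ι, W'.size = W.size + 2 ∧
      (∀ k, W.Shares k → W'.Shares k) ∧ W'.Shares fun z => g z && h z := by
  obtain ⟨α, β, hα, hβ, hs⟩ := hg
  obtain ⟨α', β', hα', hβ', hs'⟩ := hh
  let W' : BoxWiring ι :=
    { size := W.size + 2
      alice := fun s a i => if i < W.size then W.alice s a i else
        if i = W.size then α s a else α' s a
      bob := fun r b i => if i < W.size then W.bob r b i else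
        if i = W.size then β' r b else β r b
      alice_causal := fun s a a' i h => by
        split_ifs with h1
        · exact W.alice_causal s a a' i h
        · exact hα s a a' fun j hj => h j (by omega)
        · exact hα' s a a' fun j hj => h j (by omega)
      bob_causal := fun s a a' i h => by
        split_ifs with h1
        · exact W.bob_causal s a a' i h
        · exact hβ' s a a' fun j hj => h j (by omega)
        · exact hβ s a a' fun j hj => h j (by omega) }
  have hcons : ∀ s r a b, W'.Consistent s r a b → W.Consistent s r a b := by
    intro s r a b hc i hi
    have := hc i (Nat.lt_add_right 2 hi)
    simpa only [W', if_pos hi] using this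
  refine ⟨W', rfl, ?_, ?_⟩
  · rintro k ⟨α, β, hα, hβ, hs⟩
    exact ⟨α, β, fun s a a' h => hα s a a' fun j hj => h j (Nat.lt_add_right 2 hj),
      fun r b b' h => hβ r b b' fun j hj => h j (Nat.lt_add_right 2 hj),
      fun s r a b hc => hs s r a b (hcons s r a b hc)⟩
  · refine ⟨fun s a => Bool.xor (α s a && α' s a) (Bool.xor (a W.size) (a (W.size + 1))),
      fun r b => Bool.xor (β r b && β' r b) (Bool.xor (b W.size) (b (W.size + 1))), ?_, ?_, ?_⟩
    · intro s a a' h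
      have h2 := fun j (hj : j < W.size) => h j (Nat.lt_add_right 2 hj)
      simp only [hα s a a' h2, hα' s a a' h2, h W.size (Nat.lt_add_of_pos_right two_pos),
        h (W.size + 1) (Nat.lt_succ_self _)]
    · intro s a a' h
      have h2 := fun j (hj : j < W.size) => h j (Nat.lt_add_right 2 hj)
      simp only [hβ s a a' h2, hβ' s a a' h2, h W.size (Nat.lt_add_of_pos_right two_pos),
        h (W.size + 1) (Nat.lt_succ_self _)]
    · intro s r a b hc
      have h1 := hc W.size (Nat.lt_add_of_pos_right two_pos)
      have h2 := hc (W.size + 1) (Nat.lt_succ_self _)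
      simp only [W', lt_irrefl, if_false, if_true] at h1
      simp only [W', Nat.not_lt.2 (Nat.le_succ W.size), if_false, Nat.succ_ne_self] at h2
      simp only [← hs s r a b (hcons s r a b hc), ← hs' s r a b (hcons s r a b hc)]
      exact and_shared_identity _ _ _ _ _ _ _ _ h1 h2

/-- The carry is the majority of three bits, written with a single conjunction so that an adder cell
costs two boxes. -/
theorem add_add_div_two (c d : ℕ) (e : Bool) :
    (c + d + e.toNat) / 2 = c / 2 + d / 2 + (xor e
      (xor (c.testBit 0) e && xor (d.testBit 0) e)).toNat := by
  simp only [Nat.testBit_zero]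
  rcases Nat.mod_two_eq_zero_or_one c with hc | hc <;>
    rcases Nat.mod_two_eq_zero_or_one d with hd | hd <;> cases e <;> simp [hc, hd] <;> omega

theorem testBit_zero_add_add (c d : ℕ) (e : Bool) :
    (c + d + e.toNat).testBit 0 = xor (xor (c.testBit 0) (d.testBit 0)) e := by
  simp only [Nat.testBit_zero]
  rcases Nat.mod_two_eq_zero_or_one c with hc | hc <;>
    rcases Nat.mod_two_eq_zero_or_one d with hd | hd <;> cases e <;> simp [hc, hd] <;> omega

/-- The ripple-carry adder for XOR-shared numbers. -/
theorem exists_add (k : ℕ) : ∀ (W : BoxWiring ι) (c d : (ι → Bool) → ℕ) (e : (ι → Bool) → Bool),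
    (∀ z, c z < 2 ^ k) → (∀ z, d z < 2 ^ k) → (∀ j < k, W.Shares fun z => (c z).testBit j) →
    (∀ j < k, W.Shares fun z => (d z).testBit j) → W.Shares e →
    ∃ W' : BoxWiring ι, W'.size = W.size + 2 * k ∧ (∀ g, W.Shares g → W'.Shares g) ∧
      ∀ j < k + 1, W'.Shares fun z => (c z + d z + (e z).toNat).testBit j := by
  induction k with
  | zero =>
    intro W c d e hc hd _ _ he
    refine ⟨W, rfl, fun g hg => hg, fun j hj => ?_⟩
    obtain rfl : j = 0 := by omega
    have : (fun z => (c z + d z + (e z).toNat).testBit 0) = e := by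
      funext z
      have h1 : c z = 0 := by simpa using hc z
      have h2 : d z = 0 := by simpa using hd z
      cases h3 : e z <;> simp [h1, h2]
    rw [this]
    exact he
  | succ k ih =>
    intro W c d e hc hd hcW hdW he
    have hc0 := hcW 0 (Nat.succ_pos k)
    have hd0 := hdW 0 (Nat.succ_pos k)
    obtain ⟨W₁, hsize₁, hext₁, hand⟩ := W.exists_and (hc0.xor he) (hd0.xor he)
    obtain ⟨W₂, hsize₂, hext₂, hadd⟩ := ih W₁ (fun z => c z / 2) (fun z => d z / 2) _
      (fun z => by have := hc z; rw [pow_succ] at this; omega)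
      (fun z => by have := hd z; rw [pow_succ] at this; omega)
      (fun j hj => by simpa only [Nat.testBit_succ] using hext₁ _ (hcW (j + 1) (by omega)))
      (fun j hj => by simpa only [Nat.testBit_succ] using hext₁ _ (hdW (j + 1) (by omega)))
      ((hext₁ _ he).xor hand)
    refine ⟨W₂, by omega, fun g hg => hext₂ g (hext₁ g hg), fun j hj => ?_⟩
    cases j with
    | zero =>
      simp only [testBit_zero_add_add]
      exact hext₂ _ (hext₁ _ ((hc0.xor hd0).xor he))
    | succ j =>
      simp only [Nat.testBit_succ, add_add_div_two]
      exact hadd j (by omega)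

theorem sum_toNat_lt (k : ℕ) (g : ℕ → Bool) :
    ∑ i ∈ Finset.range (2 ^ k - 1), (g i).toNat < 2 ^ k := by
  have h : ∑ i ∈ Finset.range (2 ^ k - 1), (g i).toNat ≤ ∑ i ∈ Finset.range (2 ^ k - 1), 1 :=
    Finset.sum_le_sum fun i _ => Bool.toNat_le _
  rw [Finset.sum_const, Finset.card_range, smul_eq_mul, mul_one] at h
  have := Nat.two_pow_pos k
  omega

/-- The number of ones among `2 ^ k - 1` shared bits, by a tree of adders. -/
theorem exists_count (k : ℕ) : ∀ (W : BoxWiring ι) (g : ℕ → (ι → Bool) → Bool),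
    (∀ i, W.Shares (g i)) →
    ∃ W' : BoxWiring ι, W'.size + 2 * k + 2 = W.size + 2 * 2 ^ k ∧
      (∀ h, W.Shares h → W'.Shares h) ∧
      ∀ j < k, W'.Shares fun z =>
        (∑ i ∈ Finset.range (2 ^ k - 1), (g i z).toNat).testBit j := by
  induction k with
  | zero => exact fun W g _ => ⟨W, rfl, fun h hh => hh, fun j hj => absurd hj (Nat.not_lt_zero j)⟩
  | succ k ih =>
    intro W g hg
    obtain ⟨W₁, hsize₁, hext₁, hcount₁⟩ := ih W g hg
    obtain ⟨W₂, hsize₂, hext₂, hcount₂⟩ := ih W₁ (fun i => g (2 ^ k - 1 + i))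
      fun i => hext₁ _ (hg _)
    obtain ⟨W₃, hsize₃, hext₃, hadd⟩ := exists_add k W₂
      (fun z => ∑ i ∈ Finset.range (2 ^ k - 1), (g i z).toNat)
      (fun z => ∑ i ∈ Finset.range (2 ^ k - 1), (g (2 ^ k - 1 + i) z).toNat)
      (g (2 ^ k - 1 + (2 ^ k - 1))) (fun z => sum_toNat_lt k fun i => g i z)
      (fun z => sum_toNat_lt k fun i => g (2 ^ k - 1 + i) z)
      (fun j hj => hext₂ _ (hcount₁ j hj)) hcount₂ (hext₂ _ (hext₁ _ (hg _)))
    -- Two blocks of 2^k - 1 bits are counted separately; the one remaining bit enters as the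
    -- initial carry of the adder.
    have hpow : 2 ^ (k + 1) - 1 = 2 ^ k - 1 + (2 ^ k - 1) + 1 := by
      have := Nat.two_pow_pos k
      rw [pow_succ]
      omega
    refine ⟨W₃, by rw [pow_succ]; omega, fun h hh => hext₃ _ (hext₂ _ (hext₁ _ hh)), ?_⟩
    rw [hpow]
    simp only [Finset.sum_range_succ, Finset.sum_range_add]
    exact hadd

end BoxWiring

/-- The top bit of the count of 2^(k+1) - 1 bits is their majority. -/
theorem testBit_eq_decide_le {k c : ℕ} (hc : c < 2 ^ (k + 1)) :
    c.testBit k = decide (2 ^ k ≤ c) := by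
  by_cases h : 2 ^ k ≤ c
  · have : c / 2 ^ k = 1 := by
      rw [Nat.div_eq_iff (Nat.two_pow_pos k)]
      rw [pow_succ] at hc
      omega
    simp [Nat.testBit_eq_decide_div_mod_eq, this, h]
  · simp [Nat.testBit_lt_two_pow (not_le.1 h), h]

/-- The majority of `2 ^ (k + 1) - 1` XOR-shared bits takes a linear number of boxes. -/
theorem exists_majority_strategies (k : ℕ) :
    ∃ t ≤ 2 * 2 ^ (k + 1), ∃ A B : (Fin (2 ^ (k + 1) - 1) → Bool) →
        LocalStrategy (Finset.univ : Finset (Fin t)),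
      ∀ s r a b, (∀ i, xor (a i) (b i) = ((A s).input a i && (B r).input b i)) →
        xor ((A s).output a) ((B r).output b) =
          decide (2 ^ k ≤ ∑ i, (xor (s i) (r i)).toNat) := by
  let n := 2 ^ (k + 1) - 1
  obtain ⟨W, hsize, -, hcount⟩ := BoxWiring.exists_count (k + 1) (BoxWiring.nil (Fin n))
    (fun i z => if h : i < n then z ⟨i, h⟩ else false) (fun i => by
      by_cases h : i < n
      · simpa only [h, dif_pos] using BoxWiring.nil_shares_apply (⟨i, h⟩ : Fin n)
      · simpa only [h, dif_neg, not_false_eq_true] using BoxWiring.shares_false _)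
  obtain ⟨α, β, hα, hβ, hs⟩ := hcount k (Nat.lt_succ_self k)
  have hcnt : ∀ z : Fin n → Bool,
      ∑ i ∈ Finset.range n, (if h : i < n then z ⟨i, h⟩ else false).toNat =
        ∑ i, (z i).toNat := fun z => by
    rw [Finset.sum_range]
    simp
  let ext : (Fin W.size → Bool) → ℕ → Bool := fun a j => if h : j < W.size then a ⟨j, h⟩ else false
  have hext : ∀ a (i : Fin W.size), ext a i = a i := fun a i => by simp [ext]
  have hA := fun s => LocalStrategy.exists_causal (t := W.size) Finset.univ
    (fun a i => W.alice s (ext a) i) (fun a => α s (ext a))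
    (fun i _ a a' h => W.alice_causal s _ _ _ fun j hj => by
      have hj' := hj.trans i.2
      simpa only [ext, dif_pos hj'] using h ⟨j, hj'⟩ (Finset.mem_univ _) hj)
    (fun a a' h => by rw [funext fun i => h i (Finset.mem_univ i)])
  have hB := fun r => LocalStrategy.exists_causal (t := W.size) Finset.univ
    (fun a i => W.bob r (ext a) i) (fun a => β r (ext a))
    (fun i _ a a' h => W.bob_causal r _ _ _ fun j hj => by
      have hj' := hj.trans i.2
      simpa only [ext, dif_pos hj'] using h ⟨j, hj'⟩ (Finset.mem_univ _) hj)
    (fun a a' h => by rw [funext fun i => h i (Finset.mem_univ i)])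
  choose A hA1 hA2 using hA
  choose B hB1 hB2 using hB
  refine ⟨W.size, ?_, A, B, fun s r a b h => ?_⟩
  · have : (BoxWiring.nil (Fin n)).size = 0 := rfl
    omega
  · rw [hA2, hB2, hs s r (ext a) (ext b) ?_]
    · have hsum := hcnt fun i => xor (s i) (r i)
      exact (congrArg (fun c => Nat.testBit c k) hsum).trans
        (testBit_eq_decide_le (hsum ▸ BoxWiring.sum_toNat_lt (k + 1) _))
    · intro i hi
      have := h ⟨i, hi⟩
      rw [hA1 s a _ (Finset.mem_univ _), hB1 r b _ (Finset.mem_univ _)] at this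
      rw [← this, ← hext a, ← hext b]

/-! ### Independent repetition -/

theorem sum_fin_succ_pi {Ω : Type*} [Fintype Ω] (n : ℕ) (φ : (Fin (n + 1) → Ω) → ℝ) :
    ∑ ω, φ ω = ∑ o, ∑ ω : Fin n → Ω, φ (Fin.cons o ω) := by
  rw [← Equiv.sum_comp (Fin.consEquiv fun _ => Ω), Fintype.sum_prod_type]
  rfl

theorem sum_prod_weights {Ω : Type*} [Fintype Ω] {w : Ω → ℝ} (hw1 : ∑ o, w o = 1) (n : ℕ) :
    ∑ ω : Fin n → Ω, ∏ i, w (ω i) = 1 := by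
  classical
  rw [← Fintype.piFinset_univ, ← Finset.prod_univ_sum (fun _ => Finset.univ) (fun _ o => w o)]
  simp [hw1]

theorem sum_prod_weights_mul_sum {Ω : Type*} [Fintype Ω] {w Z : Ω → ℝ} (hw1 : ∑ o, w o = 1)
    (hZ : ∑ o, w o * Z o = 0) (n : ℕ) :
    ∑ ω : Fin n → Ω, (∏ i, w (ω i)) * ∑ i, Z (ω i) = 0 := by
  induction n with
  | zero => simp
  | succ n ih =>
    rw [sum_fin_succ_pi]
    simp only [Fin.prod_univ_succ, Fin.sum_univ_succ, Fin.cons_zero, Fin.cons_succ, mul_add,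
      Finset.sum_add_distrib]
    have h1 : ∀ o, ∑ ω : Fin n → Ω, (w o * ∏ i, w (ω i)) * Z o = w o * Z o := fun o => by
      rw [← Finset.sum_mul, ← Finset.mul_sum, sum_prod_weights hw1, mul_one]
    have h2 : ∀ o, ∑ ω : Fin n → Ω, (w o * ∏ i, w (ω i)) * ∑ i, Z (ω i) = 0 := fun o => by
      simp only [mul_assoc, ← Finset.mul_sum, ih, mul_zero]
    simp only [h1, h2, hZ, Finset.sum_const_zero, add_zero]

theorem sum_prod_weights_mul_sum_sq {Ω : Type*} [Fintype Ω] {w Z : Ω → ℝ} (hw1 : ∑ o, w o = 1)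
    (hZ : ∑ o, w o * Z o = 0) (n : ℕ) :
    ∑ ω : Fin n → Ω, (∏ i, w (ω i)) * (∑ i, Z (ω i)) ^ 2 = n * ∑ o, w o * Z o ^ 2 := by
  induction n with
  | zero => simp
  | succ n ih =>
    rw [sum_fin_succ_pi]
    simp only [Fin.prod_univ_succ, Fin.sum_univ_succ, Fin.cons_zero, Fin.cons_succ]
    have h1 : ∀ o, ∑ ω : Fin n → Ω, (w o * ∏ i, w (ω i)) * (Z o + ∑ i, Z (ω i)) ^ 2 =
        w o * Z o ^ 2 + w o * (n * ∑ o, w o * Z o ^ 2) := by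
      intro o
      have hexp : ∀ ω : Fin n → Ω, (w o * ∏ i, w (ω i)) * (Z o + ∑ i, Z (ω i)) ^ 2 =
          w o * Z o ^ 2 * ∏ i, w (ω i) + 2 * w o * Z o * ((∏ i, w (ω i)) * ∑ i, Z (ω i)) +
            w o * ((∏ i, w (ω i)) * (∑ i, Z (ω i)) ^ 2) := fun ω => by ring
      simp only [hexp, Finset.sum_add_distrib, ← Finset.mul_sum, ih, sum_prod_weights hw1,
        sum_prod_weights_mul_sum hw1 hZ]
      ring
    simp only [h1, Finset.sum_add_distrib, ← Finset.sum_mul, hw1]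
    push_cast
    ring

/-- Chebyshev's inequality for independent signs with positive bias. -/
theorem one_sub_le_sum_weights_pos {Ω : Type*} [Fintype Ω] {w Z : Ω → ℝ} (hw : ∀ o, 0 ≤ w o)
    (hw1 : ∑ o, w o = 1) (hZ : ∀ o, Z o ^ 2 = 1) {δ ε : ℝ} (hδ : 0 < δ)
    (hμ : δ ≤ ∑ o, w o * Z o) (n : ℕ) (hn : 1 ≤ ε * n * δ ^ 2) :
    1 - ε ≤ ∑ ω : Fin n → Ω, if 0 < ∑ i, Z (ω i) then ∏ i, w (ω i) else 0 := by
  let μ := ∑ o, w o * Z o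
  have hcent : ∑ o, w o * (Z o - μ) = 0 := by
    simp only [mul_sub, Finset.sum_sub_distrib, ← Finset.sum_mul, hw1, one_mul]
    exact sub_self μ
  have hvar : ∑ o, w o * (Z o - μ) ^ 2 ≤ 1 := by
    have hexp : ∀ o, w o * (Z o - μ) ^ 2 = w o + w o * μ ^ 2 - 2 * μ * (w o * Z o) := fun o => by
      have := hZ o
      linear_combination w o * this
    simp only [hexp, Finset.sum_sub_distrib, Finset.sum_add_distrib, ← Finset.sum_mul,
      ← Finset.mul_sum, hw1]
    have : (∑ o, w o * Z o) = μ := rfl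
    rw [this]
    nlinarith [sq_nonneg μ]
  have hsecond := sum_prod_weights_mul_sum_sq hw1 hcent n
  have hn0 : (0 : ℝ) < n := by
    rcases Nat.eq_zero_or_pos n with rfl | h
    · norm_num at hn
    · exact_mod_cast h
  have hWnn : ∀ ω : Fin n → Ω, 0 ≤ ∏ i, w (ω i) := fun ω => Finset.prod_nonneg fun i _ => hw _
  -- If the sum of signs is not positive, the centred sum is at most -nμ ≤ -nδ, so its square is at
  -- least (nδ)².
  have hbad : (∑ ω : Fin n → Ω, if 0 < ∑ i, Z (ω i) then 0 else ∏ i, w (ω i)) * (n * δ) ^ 2 ≤ n := by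
    calc _ ≤ ∑ ω : Fin n → Ω, (∏ i, w (ω i)) * (∑ i, (Z (ω i) - μ)) ^ 2 := by
          rw [Finset.sum_mul]
          refine Finset.sum_le_sum fun ω _ => ?_
          split_ifs with h
          · rw [zero_mul]
            exact mul_nonneg (hWnn ω) (sq_nonneg _)
          · refine mul_le_mul_of_nonneg_left ?_ (hWnn ω)
            rw [Finset.sum_sub_distrib, Finset.sum_const, Finset.card_univ, Fintype.card_fin,
              nsmul_eq_mul]
            have h1 : (n : ℝ) * δ ≤ n * μ := mul_le_mul_of_nonneg_left hμ hn0.le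
            have h2 : 0 < (n : ℝ) * δ := mul_pos hn0 hδ
            have h3 := not_lt.1 h
            rw [sub_sq_comm]
            exact pow_le_pow_left₀ h2.le (by linarith) 2
      _ ≤ n := by
          rw [hsecond]
          exact mul_le_of_le_one_right hn0.le hvar
  have hsplit : (∑ ω : Fin n → Ω, if 0 < ∑ i, Z (ω i) then ∏ i, w (ω i) else 0) +
      (∑ ω : Fin n → Ω, if 0 < ∑ i, Z (ω i) then 0 else ∏ i, w (ω i)) = 1 := by
    rw [← Finset.sum_add_distrib, ← sum_prod_weights hw1 n]
    exact Finset.sum_congr rfl fun ω _ => by split_ifs <;> simp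
  have hle : (∑ ω : Fin n → Ω, if 0 < ∑ i, Z (ω i) then 0 else ∏ i, w (ω i)) ≤ ε := by
    refine le_of_mul_le_mul_right (hbad.trans ?_) (pow_pos (mul_pos hn0 hδ) 2)
    nlinarith
  linarith

theorem NLComputable_of_weights {X : Type u} {Y : Type v} {ε : ℝ} {f : X → Y → Bool} {t : ℕ}
    {Ω : Type*} [Fintype Ω] {w : Ω → ℝ} (hw : ∀ o, 0 ≤ w o) (hw1 : ∑ o, w o = 1)
    (P : Ω → DetProtocol X Y t)
    (h : ∀ x y, ENNReal.ofReal (1 - ε) ≤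
      ∑ o, ENNReal.ofReal (w o) * (P o).successProb f x y) : NLComputable ε f t := by
  have hsum : ∑ o, ENNReal.ofReal (w o) = 1 := by
    rw [← ENNReal.ofReal_sum_of_nonneg fun o _ => hw o, hw1, ENNReal.ofReal_one]
  refine ⟨(PMF.ofFintype _ hsum).map P, fun x y => (h x y).trans (le_of_eq ?_)⟩
  simp only [PMF.map_apply, ← ENNReal.tsum_mul_right]
  rw [ENNReal.tsum_comm, tsum_fintype]
  refine Finset.sum_congr rfl fun o _ => ?_
  rw [tsum_eq_single (P o) fun Q hQ => by rw [if_neg hQ, zero_mul], if_pos rfl,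
    PMF.ofFintype_apply]

/-- The number of votes is odd, so a positive sum of agreements with `c` puts the count on the side
of the threshold 2^k given by `c`. -/
theorem decide_majority_eq {k : ℕ} (b : Fin (2 ^ (k + 1) - 1) → Bool) (c : Bool)
    (h : 0 < ∑ i, boolSign (xor c (b i))) : decide (2 ^ k ≤ ∑ i, (b i).toNat) = c := by
  have hsign : ∀ i, boolSign (xor c (b i)) = boolSign c * (1 - 2 * ((b i).toNat : ℝ)) := fun i => by
    rw [boolSign_xor]
    cases b i <;> norm_num [boolSign]
  simp only [hsign, ← Finset.mul_sum, Finset.sum_sub_distrib, Finset.sum_const, Finset.card_univ,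
    Fintype.card_fin, nsmul_eq_mul, mul_one] at h
  rw [← Nat.cast_sum] at h
  generalize ∑ i, (b i).toNat = m at h
  have hpos := Nat.two_pow_pos k
  have hpow : 2 ^ (k + 1) - 1 + 1 = 2 * 2 ^ k := by rw [pow_succ]; omega
  generalize 2 ^ (k + 1) - 1 = n at h hpow
  cases c
  · have h1 : 2 * m < n := by
      simp only [boolSign] at h
      have : (2 * m : ℝ) < n := by norm_num at h; linarith
      exact_mod_cast this
    simp only [decide_eq_false_iff_not]
    omega
  · have h1 : n < 2 * m := by
      simp only [boolSign] at h
      have : (n : ℝ) < 2 * m := by norm_num at h; linarith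
      exact_mod_cast this
    simp only [decide_eq_true_eq]
    omega

/-- A sign-correlated rank-one mixture gives a protocol, by majority of independent repetitions. -/
theorem NL_le_of_mem_signHull {X : Type u} {Y : Type v} {ε δ : ℝ} (hδ : 0 < δ)
    {f : X → Y → Bool} {C : X → Y → ℝ} (hC : C ∈ signHull X Y)
    (hfC : ∀ x y, δ ≤ signMatrix f x y * C x y) (k : ℕ)
    (hk : 1 ≤ ε * (2 ^ (k + 1) - 1) * δ ^ 2) : NL ε f ≤ 2 * 2 ^ (k + 1) := by
  obtain ⟨Ω, _, w, z, hw, hw1, hz, rfl⟩ := mem_convexHull_iff_exists_fintype.1 hC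
  choose p hp using hz
  obtain ⟨t, ht, A, B, hAB⟩ := exists_majority_strategies k
  let n := 2 ^ (k + 1) - 1
  have hn : ((n : ℕ) : ℝ) = 2 ^ (k + 1) - 1 := by
    simp only [n]
    rw [Nat.cast_sub Nat.one_le_two_pow]
    push_cast
    ring
  let P : (Fin n → Ω) → DetProtocol X Y t := fun ω =>
    ⟨fun x => A fun i => (p (ω i)).1 x, fun y => B fun i => (p (ω i)).2 y⟩
  refine le_trans (Nat.sInf_le ?_) ht
  refine NLComputable_of_weights (w := fun ω : Fin n → Ω => ∏ i, w (ω i))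
    (fun ω => Finset.prod_nonneg fun i _ => hw _) (sum_prod_weights hw1 n) P fun x y => ?_
  let Z : Ω → ℝ := fun o => boolSign (xor (f x y) (xor ((p o).1 x) ((p o).2 y)))
  have hμ : δ ≤ ∑ o, w o * Z o := by
    refine (hfC x y).trans (le_of_eq ?_)
    rw [Finset.sum_apply, Finset.sum_apply, Finset.mul_sum]
    refine Finset.sum_congr rfl fun o _ => ?_
    simp only [← hp, Pi.smul_apply, smul_eq_mul, Z, boolSign_xor]
    have : signMatrix f x y = boolSign (f x y) := rfl
    rw [this]
    ring
  have hcheb := one_sub_le_sum_weights_pos hw hw1 (Z := Z) (fun o => boolSign_sq _) hδ hμ n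
    (by rw [hn]; exact hk)
  refine (ENNReal.ofReal_le_ofReal hcheb).trans ?_
  rw [ENNReal.ofReal_sum_of_nonneg fun ω _ => by
    split_ifs
    · exact Finset.prod_nonneg fun i _ => hw _
    · exact le_rfl]
  refine Finset.sum_le_sum fun ω _ => ?_
  split_ifs with hpos
  · rw [DetProtocol.successProb_eq_one, mul_one]
    intro a b hab
    have hcons : ∀ i, xor (a i) (b i) =
        (((P ω).alice x).input a i && ((P ω).bob y).input b i) := by
      intro i
      by_contra hne
      exact hab (Finset.prod_eq_zero (Finset.mem_univ i) (if_neg hne))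
    exact (hAB _ _ a b hcons).trans (decide_majority_eq _ _ hpos)
  · rw [ENNReal.ofReal_zero]
    exact zero_le

/-! ### The upper bound -/

theorem exists_factorization {X : Type u} {Y : Type v} [Fintype X] (N : Matrix X Y ℝ) :
    ∃ (k : ℕ) (U : Matrix (Fin k) X ℝ) (V : Matrix (Fin k) Y ℝ), Uᵀ * V = N := by
  classical
  let e := Fintype.equivFin X
  refine ⟨Fintype.card X, Matrix.of fun i x => if e x = i then 1 else 0,
    Matrix.of fun i y => N (e.symm i) y, ?_⟩
  ext x y
  simp [Matrix.mul_apply]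

theorem one_le_maxColNorm_mul {X : Type u} {Y : Type v} [Finite X] [Finite Y]
    [Nonempty X] [Nonempty Y] (f : X → Y → Bool) {k : ℕ} (U : Matrix (Fin k) X ℝ)
    (V : Matrix (Fin k) Y ℝ) (hN : ∀ x y, 1 ≤ signMatrix f x y * (Uᵀ * V) x y) :
    1 ≤ maxColNorm U * maxColNorm V := by
  obtain ⟨x⟩ := ‹Nonempty X›
  obtain ⟨y⟩ := ‹Nonempty Y›
  refine (one_le_sq_iff₀ (mul_nonneg (maxColNorm_nonneg U) (maxColNorm_nonneg V))).1 ?_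
  have h1 : 1 ≤ ((Uᵀ * V) x y) ^ 2 := by
    have h2 : ((Uᵀ * V) x y) ^ 2 = (signMatrix f x y * (Uᵀ * V) x y) ^ 2 := by
      rw [mul_pow, pow_two (signMatrix f x y), signMatrix_mul_self, one_mul]
    rw [h2]
    exact one_le_pow₀ (hN x y)
  refine h1.trans ?_
  rw [mul_pow, Matrix.mul_apply]
  exact (Finset.sum_mul_sq_le_sq_mul_sq _ _ _).trans
    (mul_le_mul (sum_sq_le_maxColNorm_sq U x) (sum_sq_le_maxColNorm_sq V y)
      (Finset.sum_nonneg fun _ _ => sq_nonneg _) (sq_nonneg _))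

/-- Cauchy–Schwarz at a single entry bounds every candidate. Exact factorizations exist, so neither
infimum is over an empty set. -/
theorem one_le_gamma2Infty_signMatrix {X : Type u} {Y : Type v} [Fintype X] [Finite Y]
    [Nonempty X] [Nonempty Y] (f : X → Y → Bool) : 1 ≤ gamma2Infty (signMatrix f) := by
  refine le_csInf ⟨_, signMatrix f, fun x y => (signMatrix_mul_self f x y).ge, rfl⟩ ?_
  rintro _ ⟨N, hN, rfl⟩
  obtain ⟨k, U, V, hUV⟩ := exists_factorization N
  refine le_csInf ⟨_, k, U, V, hUV, rfl⟩ ?_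
  rintro _ ⟨k, U, V, rfl, rfl⟩
  exact one_le_maxColNorm_mul f U V hN

theorem exists_mem_signHull_le {X : Type u} {Y : Type v} [Fintype X] [Fintype Y]
    [Nonempty X] [Nonempty Y] (f : X → Y → Bool) :
    ∃ C ∈ signHull X Y, ∀ x y, 1 / (32 * gamma2Infty (signMatrix f)) ≤
      signMatrix f x y * C x y := by
  have hΓ1 := one_le_gamma2Infty_signMatrix f
  -- Attainment of the infima is avoided by allowing 2Γ: the normalized matrix has margin 1/(2Γ), an
  -- approximation error of 1/(4Γ) leaves 1/(4Γ), and division by 8 gives 1/(32Γ).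
  set Γ := gamma2Infty (signMatrix f) with hΓ
  obtain ⟨_, ⟨N, hN, rfl⟩, hNΓ⟩ := exists_lt_of_csInf_lt
    (s := {c | ∃ N : Matrix X Y ℝ, (∀ i j, 1 ≤ signMatrix f i j * N i j) ∧ c = gamma2 N})
    ⟨_, signMatrix f, fun x y => (signMatrix_mul_self f x y).ge, rfl⟩ (show Γ < 2 * Γ by linarith)
  obtain ⟨k₀, U₀, V₀, hUV₀⟩ := exists_factorization N
  obtain ⟨_, ⟨k, U, V, rfl, rfl⟩, hc⟩ := exists_lt_of_csInf_lt
    (s := {c | ∃ (k : ℕ) (U : Matrix (Fin k) X ℝ) (V : Matrix (Fin k) Y ℝ),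
      Uᵀ * V = N ∧ c = maxColNorm U * maxColNorm V}) ⟨_, k₀, U₀, V₀, hUV₀, rfl⟩ hNΓ
  have hab := one_le_maxColNorm_mul f U V hN
  have hU : ∀ x, ∑ i, (U i x / maxColNorm U) ^ 2 ≤ 1 := fun x => by
    simp only [div_pow, ← Finset.sum_div]
    exact div_le_one_of_le₀ (sum_sq_le_maxColNorm_sq U x) (sq_nonneg _)
  have hV : ∀ y, ∑ i, (V i y / maxColNorm V) ^ 2 ≤ 1 := fun y => by
    simp only [div_pow, ← Finset.sum_div]
    exact div_le_one_of_le₀ (sum_sq_le_maxColNorm_sq V y) (sq_nonneg _)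
  obtain ⟨m, hm⟩ := exists_pow_lt_of_lt_one (show 0 < 1 / (4 * Γ) by positivity)
    (show (1 / 2 : ℝ) < 1 by norm_num)
  obtain ⟨C, hC, hCerr⟩ := exists_mem_signHull_abs_sub_le m
    (fun x i => U i x / maxColNorm U) (fun y i => V i y / maxColNorm V) hU hV
  refine ⟨C, hC, fun x y => ?_⟩
  have hprod : ∑ i, U i x / maxColNorm U * (V i y / maxColNorm V) =
      (Uᵀ * V) x y / (maxColNorm U * maxColNorm V) := by
    simp only [Matrix.mul_apply, Matrix.transpose_apply, Finset.sum_div, div_mul_div_comm]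
  have herr := hCerr x y
  rw [hprod] at herr
  have hsign : |signMatrix f x y| = 1 := by
    cases hf : f x y <;> simp [signMatrix, hf]
  have herr' : signMatrix f x y * ((Uᵀ * V) x y / (maxColNorm U * maxColNorm V) - 8 * C x y) ≤
      1 / (4 * Γ) := by
    refine (le_abs_self _).trans ?_
    rw [abs_mul, hsign, one_mul]
    exact herr.trans hm.le
  have hmain : 1 / (2 * Γ) ≤
      signMatrix f x y * ((Uᵀ * V) x y / (maxColNorm U * maxColNorm V)) := by
    rw [← mul_div_assoc]
    exact div_le_div₀ (zero_le_one.trans (hN x y)) (hN x y) (by linarith) hc.le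
  have h4 : 1 / (4 * Γ) = 8 * (1 / (32 * Γ)) := by field_simp; norm_num
  have h2 : 1 / (2 * Γ) = 16 * (1 / (32 * Γ)) := by field_simp; norm_num
  rw [h4] at herr'
  rw [h2] at hmain
  linarith

theorem NL_le_gamma2Infty_sq {X : Type u} {Y : Type v} [Fintype X] [Fintype Y] {ε : ℝ}
    (hε0 : 0 < ε) (hε : ε < 1 / 2) (f : X → Y → Bool) :
    (NL ε f : ℝ) ≤ 16384 / ε * gamma2Infty (signMatrix f) ^ 2 := by
  by_cases hne : Nonempty X ∧ Nonempty Y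
  · obtain ⟨hX, hY⟩ := hne
    obtain ⟨C, hC, hfC⟩ := exists_mem_signHull_le f
    have hΓ := one_le_gamma2Infty_signMatrix f
    set Γ := gamma2Infty (signMatrix f)
    have hΓ2 : 1 ≤ Γ ^ 2 := one_le_pow₀ hΓ
    -- With δ = 1/(32Γ), R is 1/(εδ²), the number of repetitions Chebyshev needs. Rounding to
    -- 2^(k+1) - 1 costs at most 4(R + 1) ≤ 8R boxes, within the claimed 16R.
    let R := 1024 / ε * Γ ^ 2
    have hR : 1 ≤ R := by
      have h1 : 1 ≤ 1024 / ε := (one_le_div hε0).2 (by linarith)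
      exact one_le_mul_of_one_le_of_one_le h1 hΓ2
    obtain ⟨k, hk1, hk2⟩ := exists_nat_pow_near (by linarith : 1 ≤ R + 1) (one_lt_two (α := ℝ))
    have hNL := NL_le_of_mem_signHull (ε := ε) (by positivity) hC hfC k (by
      have hid : ε * R * (1 / (32 * Γ)) ^ 2 = 1 := by
        simp only [R]
        field_simp
        norm_num
      have hle : R ≤ 2 ^ (k + 1) - 1 := by linarith
      refine hid.ge.trans ?_
      gcongr)
    have hNL' : (NL ε f : ℝ) ≤ 2 * 2 ^ (k + 1) := by exact_mod_cast hNL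
    rw [pow_succ] at hNL'
    have hfin : 16384 / ε * Γ ^ 2 = 16 * R := by simp only [R]; ring
    rw [hfin]
    linarith
  · have h0 : NL ε f = 0 := by
      refine Nat.eq_zero_of_le_zero (Nat.sInf_le ?_)
      refine ⟨PMF.pure ⟨fun _ => .halt false, fun _ => .halt false⟩, fun x y => ?_⟩
      exact absurd ⟨⟨x⟩, ⟨y⟩⟩ hne
    rw [h0, Nat.cast_zero]
    positivity

theorem mainTheorem11 :
    (∀ ε : ℝ, 0 ≤ ε → ε < 1 / 2 → ∀ α : ℝ, α = 1 / (1 - 2 * ε) →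
      ∀ (X : Type u) (Y : Type v) [Fintype X] [Fintype Y] (f : X → Y → Bool),
        2 * Real.logb 2 (gamma2Approx α (signMatrix f) / α) ≤ (NL ε f : ℝ)) ∧
    (∀ ε : ℝ, 0 < ε → ε < 1 / 2 → ∃ C : ℝ, 0 < C ∧
      ∀ (X : Type u) (Y : Type v) [Fintype X] [Fintype Y] (f : X → Y → Bool),
        (NL ε f : ℝ) ≤ C * gamma2Infty (signMatrix f) ^ 2) := by
  refine ⟨fun ε hε0 hε α hα X Y _ _ f => two_mul_logb_gamma2Approx_le_NL hε0 hε hα f,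
    fun ε hε0 hε => ⟨16384 / ε, by positivity, fun X Y _ _ f => NL_le_gamma2Infty_sq hε0 hε f⟩⟩
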